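/- Let $\Delta$ be the category of nonempty finite ordinals, $\dot\Delta$ the category of all finite ordinals (with order-preserving maps), and $j:\Delta\to\dot\Delta$ the full inclusion; all are regarded as locally discrete $2$-categories. Let $\Delta_3$ be the category generated by $d^0,d^1:\mathsf 1\to\mathsf 2$, $s^0:\mathsf 2\to\mathsf 1$, $\partial^0,\partial^1,\partial^2:\mathsf 2\to\mathsf 3$ subject to $\partial^k d^i=\partial^i d^{k-1}$ ($i<k$) and $s^0d^0=s^0d^1=\mathrm{id}$, with inclusion $t_3:\Delta_3\to\Delta$. Write $\nabla\mathsf n$ for the localization of the ordinal $\mathsf n$, viewed as a category, at all its morphisms. For pseudofunctors $W:\mathfrak A\to\mathrm{CAT}$ and $\mathcal B:\mathfrak A\to\mathfrak H$, a $W$-weighted bilimit of $\mathcal B$ is an object $L$ of $\mathfrak H$ with a pseudonatural transformation $\rho:W\to\mathfrak H(L,\mathcal B-)$ such that $f\mapsto\mathfrak H(f,\mathcal B-)\,\rho$ is an equivalence of categories $\mathfrak H(X,L)\simeq[\mathfrak A,\mathrm{CAT}]_{PS}(W,\mathfrak H(X,\mathcal B-))$ for every $X$; it is conical if $W$ is constant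 at the terminal category. A right pseudo-Kan extension $\mathrm{PsRan}_{j}\mathcal A$ is a pseudofunctor $R:\dot\Delta\to\mathfrak H$ with a pseudonatural transformation $\varepsilon:R\circ j\to\mathcal A$ such that $\alpha\mapsto\varepsilon\,(\alpha j)$ is an equivalence of categories $[\dot\Delta,\mathfrak H]_{PS}(S,R)\simeq[\Delta,\mathfrak H]_{PS}(S\circ j,\mathcal A)$ for every pseudofunctor $S:\dot\Delta\to\mathfrak H$. Let $\mathfrak H$ be a $2$-category and $\mathcal A:\Delta\to\mathfrak H$ a pseudofunctor. A descent object $\mathrm{Desc}(\mathcal A)$ is a bilimit of $\mathcal A\circ t_3$ weighted by $\nabla\mathsf 1\rightrightarrows\nabla\mathsf 2\to\nabla\mathsf 3$, that is, by $\mathsf n\mapsto\nabla\mathsf n$ on $\Delta_3$. Then: 1. An object of $\mathfrak H$ is a descent object of $\mathcal A$ if and only if it is a conical bilimit of $\mathcal A$. 2. A descent object of $\mathcal A$ exists if and only if, for every $\mathsf n$ in $\dot\Delta$, the bilimit of $\mathcal A$ weighted by $\dot\Delta(\mathsf n,j-)$ exists. (In particular this holds if $\mathfrak H$ is bicategorically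 complete.) 3. If a descent object of $\mathcal A$ exists, then $\mathrm{PsRan}_j\mathcal A$ exists, and for every choice of $\mathrm{Desc}(\mathcal A)$ and $\mathrm{PsRan}_j\mathcal A$ there is an equivalence in $\mathfrak H$ $$\mathrm{Desc}(\mathcal A)\simeq\mathrm{PsRan}_j\mathcal A(\mathsf 0).$$ -/

import Mathlib

open CategoryTheory Bicategory Opposite
open scoped CategoryTheory.Pseudofunctor.StrongTrans

universe w v u

namespace PseudoKan

/-! ### Whiskering of pseudonatural transformations with a pseudofunctor -/

section Precomposition

universe w₁ v₁ u₁ w₂ v₂ u₂ w₃ v₃ u₃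

variable {B : Type u₁} [Bicategory.{w₁, v₁} B] {C : Type u₂} [Bicategory.{w₂, v₂} C]
  {D : Type u₃} [Bicategory.{w₃, v₃} D]

lemma naturality_id_aux {F G : C ⥤ᵖ D} (α : F ⟶ G) {c : C} {k : c ⟶ c} (p : k ⟶ 𝟙 c) :
    (α.naturality k).hom ≫ α.app c ◁ (G.map₂ p ≫ (G.mapId c).hom) =
      (F.map₂ p ≫ (F.mapId c).hom) ▷ α.app c ≫ (λ_ (α.app c)).hom ≫ (ρ_ (α.app c)).inv := by
  rw [Bicategory.whiskerLeft_comp, ← Category.assoc,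
    ← Pseudofunctor.StrongTrans.naturality_naturality, Category.assoc,
    Pseudofunctor.StrongTrans.naturality_id, Bicategory.comp_whiskerRight, Category.assoc]

lemma naturality_comp_aux {F G : C ⥤ᵖ D} (α : F ⟶ G) {a b c : C} {k : a ⟶ c} {f : a ⟶ b}
    {g : b ⟶ c} (p : k ⟶ f ≫ g) :
    (α.naturality k).hom ≫ α.app a ◁ (G.map₂ p ≫ (G.mapComp f g).hom) =
      (F.map₂ p ≫ (F.mapComp f g).hom) ▷ α.app c ≫ (α_ _ _ _).hom ≫
        F.map f ◁ (α.naturality g).hom ≫ (α_ _ _ _).inv ≫ (α.naturality f).hom ▷ G.map g ≫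
          (α_ _ _ _).hom := by
  rw [Bicategory.whiskerLeft_comp, ← Category.assoc,
    ← Pseudofunctor.StrongTrans.naturality_naturality, Category.assoc,
    Pseudofunctor.StrongTrans.naturality_comp, Bicategory.comp_whiskerRight, Category.assoc]

/-- The pseudonatural transformation `α t : F ∘ t ⟶ G ∘ t` obtained from `α : F ⟶ G`. -/
def precompTrans (t : B ⥤ᵖ C) {F G : C ⥤ᵖ D} (α : F ⟶ G) : t.comp F ⟶ t.comp G where
  app b := α.app (t.obj b)
  naturality f := α.naturality (t.map f)
  naturality_naturality η := α.naturality_naturality (t.map₂ η)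
  naturality_id b := naturality_id_aux α (t.mapId b).hom
  naturality_comp f g := naturality_comp_aux α (t.mapComp f g).hom

/-- The action of `[t, D] : [C, D] ⥤ [B, D]` on hom-categories, `α ↦ α t`. -/
def precompFunctor (t : B ⥤ᵖ C) (F G : C ⥤ᵖ D) : (F ⟶ G) ⥤ (t.comp F ⟶ t.comp G) where
  obj α := precompTrans t α
  map Γ := ⟨{ app := fun b => Γ.as.app (t.obj b)
              naturality := fun f => Γ.as.naturality (t.map f) }⟩

/-- The functor `[C, D](S, R) ⥤ [B, D](S ∘ t, A)` sending `α` to `e · (α t)`. -/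
def kanComparison (t : B ⥤ᵖ C) (A : B ⥤ᵖ D) (R : C ⥤ᵖ D) (e : t.comp R ⟶ A) (S : C ⥤ᵖ D) :
    (S ⟶ R) ⥤ (t.comp S ⟶ A) :=
  precompFunctor t S R ⋙ (postcomposing (t.comp S) (t.comp R) A).obj e

/-- `R` is a right pseudo-Kan extension of `A` along `t`: it is a right bicategorical reflection
of `A` along `[t, D] : [C, D] ⥤ [B, D]`, with some universal arrow `e : R ∘ t ⟶ A`. -/
def IsRightPseudoKanExtension (t : B ⥤ᵖ C) (A : B ⥤ᵖ D) (R : C ⥤ᵖ D) : Prop :=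
  ∃ e : t.comp R ⟶ A, ∀ S : C ⥤ᵖ D, (kanComparison t A R e S).IsEquivalence

end Precomposition

/-! ### Weighted bilimits -/

section Bilimit

universe w₁ v₁ u₁

variable {B : Type u₁} [Bicategory.{w₁, v₁} B] {H : Type u} [Bicategory.{w, v} H]

lemma cat_hom₂_ext {X Y : Cat.{w, v}} {F G : X ⟶ Y} {p q : F ⟶ G}
    (h : ∀ x : X, p.toNatTrans.app x = q.toNatTrans.app x) : p = q :=
  Cat.Hom₂.ext (NatTrans.ext (funext h))

/-- The covariant representable pseudofunctor `H(X, -) : H ⥤ Cat`. -/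
def homFrom (X : H) : H ⥤ᵖ Cat.{w, v} where
  obj Y := Cat.of (X ⟶ Y)
  map f := (postcomp X f).toCatHom
  map₂ η := ((postcomposing X _ _).map η).toCatHom₂
  map₂_id f := cat_hom₂_ext fun k => Bicategory.whiskerLeft_id k f
  map₂_comp η θ := cat_hom₂_ext fun k => Bicategory.whiskerLeft_comp k η θ
  mapId Y := rightUnitorNatIsoCat X Y
  mapComp f g := (associatorNatIsoLeftCat X f g).symm
  map₂_whisker_left {_ _ _} f {g h} η := cat_hom₂_ext fun (k : X ⟶ _) =>
    show k ◁ (f ◁ η) = (α_ k f g).inv ≫ (k ≫ f) ◁ η ≫ (α_ k f h).hom by simp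
  map₂_whisker_right {_ _ _ f g} η h := cat_hom₂_ext fun (k : X ⟶ _) =>
    show k ◁ (η ▷ h) = (α_ k f h).inv ≫ (k ◁ η) ▷ h ≫ (α_ k g h).hom by simp
  map₂_associator f g h := cat_hom₂_ext fun (k : X ⟶ _) =>
    show k ◁ (α_ f g h).hom = (α_ k (f ≫ g) h).inv ≫ (α_ k f g).inv ▷ h ≫ 𝟙 _ ≫
      (α_ (k ≫ f) g h).hom ≫ (α_ k f (g ≫ h)).hom by simp
  map₂_left_unitor f := cat_hom₂_ext fun (k : X ⟶ _) =>
    show k ◁ (λ_ f).hom = (α_ k (𝟙 _) f).inv ≫ (ρ_ k).hom ▷ f ≫ 𝟙 _ by simp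
  map₂_right_unitor f := cat_hom₂_ext fun (k : X ⟶ _) =>
    show k ◁ (ρ_ f).hom = (α_ k f (𝟙 _)).inv ≫ (ρ_ (k ≫ f)).hom ≫ 𝟙 _ by simp

/-- The pseudonatural transformation `H(f, -) : H(Y, -) ⟶ H(X, -)`. -/
def homFromMap {X Y : H} (f : X ⟶ Y) : homFrom Y ⟶ homFrom X where
  app Z := (precomp Z f).toCatHom
  naturality g := (associatorNatIsoMiddleCat f g).symm
  naturality_naturality {_ _ g h} η := cat_hom₂_ext fun (k : Y ⟶ _) =>
    show f ◁ (k ◁ η) ≫ (α_ f k h).inv = (α_ f k g).inv ≫ (f ≫ k) ◁ η by simp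
  naturality_id a := cat_hom₂_ext fun (k : Y ⟶ a) =>
    show (α_ f k (𝟙 a)).inv ≫ (ρ_ (f ≫ k)).hom = f ◁ (ρ_ k).hom ≫ 𝟙 _ ≫ 𝟙 _ by simp
  naturality_comp g h := cat_hom₂_ext fun (k : Y ⟶ _) =>
    show (α_ f k (g ≫ h)).inv ≫ (α_ (f ≫ k) g h).inv = f ◁ (α_ k g h).inv ≫ 𝟙 _ ≫
      (α_ f (k ≫ g) h).inv ≫ 𝟙 _ ≫ (α_ f k g).inv ▷ h ≫ 𝟙 _ by simp

/-- The assignment `f ↦ H(f, -)` as a functor. -/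
def homFromFunctor (X Y : H) : (X ⟶ Y) ⥤ (homFrom Y ⟶ homFrom X) where
  obj f := homFromMap f
  map {f f'} η := ⟨{
    app := fun Z => ((precomposing X Y Z).map η).toCatHom₂
    naturality := fun g => cat_hom₂_ext fun (k : Y ⟶ _) =>
      show η ▷ (k ≫ g) ≫ (α_ f' k g).inv = (α_ f k g).inv ≫ (η ▷ k) ▷ g by simp }⟩
  map_id f := Pseudofunctor.StrongTrans.homCategory.ext fun Z =>
    cat_hom₂_ext fun (k : Y ⟶ Z) => Bicategory.id_whiskerRight f k
  map_comp η θ := Pseudofunctor.StrongTrans.homCategory.ext fun Z =>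
    cat_hom₂_ext fun (k : Y ⟶ Z) => Bicategory.comp_whiskerRight η θ k

/-- The functor `H(X, L) ⥤ [B, Cat](W, H(X, A -))` sending `f` to `H(f, A -) · r`. -/
def bilimitComparison (W : B ⥤ᵖ Cat.{w, v}) (A : B ⥤ᵖ H) (L : H)
    (r : W ⟶ A.comp (homFrom L)) (X : H) : (X ⟶ L) ⥤ (W ⟶ A.comp (homFrom X)) :=
  homFromFunctor X L ⋙ precompFunctor A (homFrom L) (homFrom X) ⋙
    (precomposing W (A.comp (homFrom L)) (A.comp (homFrom X))).obj r

/-- `L` is a `W`-weighted bilimit of `A`: there is a universal `r : W ⟶ H(L, A -)`, inducing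
equivalences `H(X, L) ≌ [B, Cat](W, H(X, A -))` for all `X`. -/
def IsWeightedBilimit (W : B ⥤ᵖ Cat.{w, v}) (A : B ⥤ᵖ H) (L : H) : Prop :=
  ∃ r : W ⟶ A.comp (homFrom L), ∀ X : H, (bilimitComparison W A L r X).IsEquivalence

end Bilimit

/-! ### Weights -/

section Weights

attribute [local instance] uliftCategory

/-- The universe lift of a functor between small categories. -/
def liftFunctor {K L : Type} [Category.{0} K] [Category.{0} L] (F : K ⥤ L) :
    ULiftHom.{w} (ULift.{v} K) ⥤ ULiftHom.{w} (ULift.{v} L) :=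
  ULiftHom.down ⋙ ULift.downFunctor ⋙ F ⋙ ULift.upFunctor ⋙ ULiftHom.up

/-- The change of universe from `Cat.{0, 0}` to `Cat.{w, v}`. -/
def catLift : Cat.{0, 0} ⥤ Cat.{w, v} where
  obj K := Cat.of (ULiftHom.{w} (ULift.{v} K))
  map F := (liftFunctor.{w, v} F.toFunctor).toCatHom
  map_id _ := rfl
  map_comp _ _ := rfl

universe v₁ u₁

variable {C : Type u₁} [Category.{v₁} C]

/-- The weight on a category, seen as a locally discrete `2`-category, that is given by a strict
functor with values in small categories. -/
def weight (F : C ⥤ Cat.{0, 0}) : LocallyDiscrete C ⥤ᵖ Cat.{w, v} :=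
  (F ⋙ catLift.{w, v}).toPseudofunctor'

variable (C) in
/-- The terminal weight, constant at the terminal category. -/
def terminalWeight : LocallyDiscrete C ⥤ᵖ Cat.{w, v} :=
  weight ((Functor.const C).obj (Cat.of (Discrete PUnit.{1})))

/-- The weight `K(b, j -)` for a functor `j : C ⥤ K` between (locally small) categories; its values
are discrete categories. -/
def representableWeight {K : Type u₁} [Category.{0} K] (j : C ⥤ K) (b : K) :
    LocallyDiscrete C ⥤ᵖ Cat.{w, v} :=
  weight (j ⋙ coyoneda.obj (op b) ⋙ typeToCat)

/-- The functor induced between the localizations at all morphisms. -/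
noncomputable def invertAllMap {K L : Type} [Category.{0} K] [Category.{0} L] (F : K ⥤ L) :
    (⊤ : MorphismProperty K).Localization ⥤ (⊤ : MorphismProperty L).Localization :=
  Localization.Construction.lift (F ⋙ (⊤ : MorphismProperty L).Q)
    fun _ _ f _ => (⊤ : MorphismProperty L).Q_inverts (F.map f) trivial

lemma Q_invertAllMap {K L : Type} [Category.{0} K] [Category.{0} L] (F : K ⥤ L) :
    (⊤ : MorphismProperty K).Q ⋙ invertAllMap F = F ⋙ (⊤ : MorphismProperty L).Q :=
  Localization.Construction.fac _ _

/-- `∇`: the localization of a category with respect to all its morphisms. -/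
noncomputable def invertAll : Cat.{0, 0} ⥤ Cat.{0, 0} where
  obj K := Cat.of (⊤ : MorphismProperty K).Localization
  map F := (invertAllMap F.toFunctor).toCatHom
  map_id K := Cat.ext (Localization.Construction.uniq _ _ (Q_invertAllMap _))
  map_comp F G := Cat.ext (Localization.Construction.uniq _ _ (by
    refine (Q_invertAllMap _).trans ?_
    change _ = (_ ⋙ invertAllMap F.toFunctor) ⋙ invertAllMap G.toFunctor
    rw [Q_invertAllMap, Functor.assoc, Q_invertAllMap]
    rfl))

end Weights

/-! ### The truncated category `Δ₃` -/

/-- The objects `1`, `2`, `3` of `Δ₃`. -/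
inductive Delta3Quiver : Type
  | one
  | two
  | three

namespace Delta3Quiver

/-- The generating morphisms of `Δ₃`. -/
inductive Hom : Delta3Quiver → Delta3Quiver → Type
  /-- The faces `d⁰, d¹ : 1 ⟶ 2`. -/
  | d (i : Fin 2) : Hom one two
  /-- The degeneracy `s⁰ : 2 ⟶ 1`. -/
  | s : Hom two one
  /-- The faces `∂⁰, ∂¹, ∂² : 2 ⟶ 3`. -/
  | del (k : Fin 3) : Hom two three

instance : Quiver Delta3Quiver where
  Hom := Hom

/-- The path consisting of one generator. -/
abbrev gen {a b : Delta3Quiver} (f : Hom a b) :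
    (Paths.of Delta3Quiver).obj a ⟶ (Paths.of Delta3Quiver).obj b :=
  (Paths.of Delta3Quiver).map f

/-- The relations `∂ᵏ dⁱ = ∂ⁱ dᵏ⁻¹` for `i < k`, and `s⁰ d⁰ = s⁰ d¹ = 1`. -/
inductive rel : HomRel (Paths Delta3Quiver)
  | del_d (i j : Fin 2) (h : i ≤ j) :
      rel (gen (Hom.d i) ≫ gen (Hom.del j.succ)) (gen (Hom.d j) ≫ gen (Hom.del i.castSucc))
  | s_d (i : Fin 2) : rel (gen (Hom.d i) ≫ gen Hom.s) (𝟙 _)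

end Delta3Quiver

/-- The category `Δ₃` generated by `d⁰, d¹ : 1 ⟶ 2`, `s⁰ : 2 ⟶ 1` and `∂⁰, ∂¹, ∂² : 2 ⟶ 3`, subject
to the cosimplicial identities between them. -/
abbrev Delta3 : Type := CategoryTheory.Quotient Delta3Quiver.rel

open scoped Simplicial in
/-- The interpretation of the generators of `Δ₃` in `Δ` (the ordinal `n` is `⦋n - 1⦌`). -/
def delta3Prefunctor : Delta3Quiver ⥤q SimplexCategory where
  obj
    | .one => ⦋0⦌
    | .two => ⦋1⦌
    | .three => ⦋2⦌
  map
    | .d i => SimplexCategory.δ i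
    | .s => SimplexCategory.σ 0
    | .del k => SimplexCategory.δ k

/-- The inclusion `t₃ : Δ₃ ⥤ Δ`. -/
def t3 : Delta3 ⥤ SimplexCategory :=
  CategoryTheory.Quotient.lift Delta3Quiver.rel (Paths.lift delta3Prefunctor) (by
    intro _ _ _ _ h
    cases h with
    | del_d i k h =>
      simp only [Functor.map_comp]
      change SimplexCategory.δ _ ≫ SimplexCategory.δ _ = SimplexCategory.δ _ ≫ SimplexCategory.δ _
      exact SimplexCategory.δ_comp_δ h
    | s_d i =>
      simp only [Functor.map_comp]
      fin_cases i
      · exact SimplexCategory.δ_comp_σ_self (i := (0 : Fin 1))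
      · exact SimplexCategory.δ_comp_σ_succ (i := (0 : Fin 1)))

/-! ### Descent objects -/

/-- The weight `∇1 ⇉ ∇2 → ∇3` on `Δ₃`, sending an ordinal to its localization at all morphisms. -/
noncomputable def descentWeight : LocallyDiscrete Delta3 ⥤ᵖ Cat.{w, v} :=
  weight (t3 ⋙ SimplexCategory.toCat ⋙ invertAll)

/-- The inclusion `j` of the category `Δ` of nonempty finite ordinals into the category of all
finite ordinals; the latter is `Δ` with an initial object (the ordinal `0`) adjoined. -/
abbrev j : SimplexCategory ⥤ AugmentedSimplexCategory := AugmentedSimplexCategory.inclusion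

/-- The ordinal `0`, i.e. the initial object of the category of finite ordinals. -/
abbrev zeroOrdinal : AugmentedSimplexCategory := WithInitial.star

variable {H : Type u} [Bicategory.{w, v} H]

/-- `L` is a descent object `Desc(A)` of `A`: a bilimit of `A ∘ t₃` weighted by
`∇1 ⇉ ∇2 → ∇3`. -/
def IsDescentObject (A : LocallyDiscrete SimplexCategory ⥤ᵖ H) (L : H) : Prop :=
  IsWeightedBilimit descentWeight (t3.toPseudofunctor.comp A) L

/-- `L` is a conical bilimit of `A`. -/
def IsConicalBilimit {C : Type} [Category.{0} C] (A : LocallyDiscrete C ⥤ᵖ H) (L : H) : Prop :=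
  IsWeightedBilimit (terminalWeight C) A L

end PseudoKan

/-!
All three parts compare a given notion with that of a universal pseudocone over `A`
(`PseudoCone.IsUniversal`), i.e. a conical bilimit in unpacked form.

If every value of a weight `W` is equivalent to the terminal category, then every pseudonatural
transformation `W ⟶ H(X, A -)` is isomorphic to an essentially unique one with constant components,
which is the same as a pseudocone with vertex `X`. Therefore a `W`-weighted bilimit of `A` is a
universal pseudocone (`isWeightedBilimit_iff_of_isContractible`). This applies to the terminal
weight, to the weight `∇1 ⇉ ∇2 → ∇3` and to the weight represented by the ordinal `0`.

A descent object is thus a universal pseudocone over `A ∘ t₃`, and it remains to show that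
restriction along `t₃` is an equivalence from pseudocones over `A` to pseudocones over `A ∘ t₃`
(`isEquivalence_restriction_t3`). Pseudocones are cocartesian sections of the category `Total A X`
of pairs `(c, x : X ⟶ A c)`, so that the required coherence reduces to equations of morphisms in
this `1`-category, which can be checked after composition with cocartesian morphisms. A pseudocone
over `A ∘ t₃` is extended to a simplex `n` by transporting its value at `1` along the initial vertex
of `n`. A map `f : n ⟶ m` moves the initial vertex of `n` to some vertex of `m`, and the edge from
the initial vertex of `m` to this vertex provides the comparison `2`-cell. Its compatibility with
composition is the cocycle condition on a triangle of `m` (`DescentDiagram.vertexMap_tr`).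

For a nonempty ordinal `n`, the weight represented by `n` is corepresentable since `j` is fully
faithful, and the bilimit is `A n` by the bicategorical Yoneda lemma
(`Corepresentation.isWeightedBilimit`).
So only the ordinal `0` imposes a condition, namely that a universal pseudocone exists.

Finally, the category of all finite ordinals is `Δ` with an initial object adjoined. A pseudofunctor
`R` on it amounts to its restriction to `Δ` together with a pseudocone over this restriction
(`starCone R`), and if this pseudocone is universal then restriction of transformations `S ⟶ R` is
an equivalence (`isEquivalence_precompFunctor`). Extending `A` by a universal pseudocone
(`coneExtension`) hence gives a right pseudo-Kan extension whose value at `0` is the vertex, i.e.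
the descent object. Right pseudo-Kan extensions are unique up to equivalence
(`IsRightPseudoKanExtension.nonempty_equivalence`), so this holds for all of them.
-/

namespace PseudoKan

/-! ### Pseudocones -/

section PseudoCones

universe w₁ v₁ u₁

variable {K : Type u₁} [Bicategory.{w₁, v₁} K]
  {H : Type u} [Bicategory.{w, v} H]

/-- A pseudocone over `A` with vertex `X`: a pseudonatural transformation from the constant
pseudofunctor at `X` to `A`, in unpacked form. -/
structure PseudoCone (A : K ⥤ᵖ H) (X : H) where
  /-- The legs of the pseudocone. -/
  leg (c : K) : X ⟶ A.obj c
  /-- The invertible `2`-cells filling the triangles of the pseudocone. -/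
  iso {c d : K} (f : c ⟶ d) : leg c ≫ A.map f ≅ leg d
  iso_id (c : K) : (iso (𝟙 c)).hom = leg c ◁ (A.mapId c).hom ≫ (ρ_ (leg c)).hom
  iso_comp {c d e : K} (f : c ⟶ d) (g : d ⟶ e) :
    (iso (f ≫ g)).hom = leg c ◁ (A.mapComp f g).hom ≫
      (α_ (leg c) (A.map f) (A.map g)).inv ≫
        (iso f).hom ▷ A.map g ≫ (iso g).hom

namespace PseudoCone

variable {A : K ⥤ᵖ H} {X L : H}

/-- A morphism of pseudocones with the same vertex: a modification. -/
@[ext]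
structure Hom (p q : PseudoCone A X) where
  /-- The components of the modification. -/
  app (c : K) : p.leg c ⟶ q.leg c
  naturality {c d : K} (f : c ⟶ d) :
    (p.iso f).hom ≫ app d = app c ▷ A.map f ≫ (q.iso f).hom

instance : Category (PseudoCone A X) where
  Hom := Hom
  id p := { app := fun c => 𝟙 _, naturality := by simp }
  comp Γ Θ :=
    { app := fun c => Γ.app c ≫ Θ.app c
      naturality := fun f => by
        rw [← Category.assoc, Γ.naturality, Category.assoc, Θ.naturality]; simp }

@[ext]
lemma hom_ext {p q : PseudoCone A X} {Γ Θ : p ⟶ q} (h : ∀ c, Hom.app Γ c = Hom.app Θ c) : Γ = Θ :=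
  Hom.ext (funext h)

@[simp]
lemma id_app (p : PseudoCone A X) (c : K) : Hom.app (𝟙 p) c = 𝟙 _ := rfl

@[simp]
lemma comp_app {p q r : PseudoCone A X} (Γ : p ⟶ q) (Θ : q ⟶ r) (c : K) :
    Hom.app (Γ ≫ Θ) c = Hom.app Γ c ≫ Hom.app Θ c := rfl

/-- An isomorphism of pseudocones, given by invertible components. -/
def isoMk {p q : PseudoCone A X} (app : ∀ c, p.leg c ≅ q.leg c)
    (naturality : ∀ {c d : K} (f : c ⟶ d),
      (p.iso f).hom ≫ (app d).hom = (app c).hom ▷ A.map f ≫ (q.iso f).hom) : p ≅ q where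
  hom := { app := fun c => (app c).hom, naturality := naturality }
  inv :=
    { app := fun c => (app c).inv
      naturality := fun {c d} f => by
        have h := (app c).inv ▷ A.map f ≫= naturality f =≫ (app d).inv
        simpa using h.symm }
  hom_inv_id := by ext c; simp
  inv_hom_id := by ext c; simp

/-- The component of an isomorphism of pseudocones. -/
def isoApp {p q : PseudoCone A X} (e : p ≅ q) (c : K) : p.leg c ≅ q.leg c where
  hom := Hom.app e.hom c
  inv := Hom.app e.inv c
  hom_inv_id := by rw [← comp_app, e.hom_inv_id, id_app]
  inv_hom_id := by rw [← comp_app, e.inv_hom_id, id_app]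

/-- The pseudocone `f ≫ p` obtained by changing the vertex of `p` along `f`. -/
@[simps]
def whisker (p : PseudoCone A L) (f : X ⟶ L) : PseudoCone A X where
  leg c := f ≫ p.leg c
  iso g := α_ _ _ _ ≪≫ whiskerLeftIso f (p.iso g)
  iso_id c := by simp [p.iso_id]
  iso_comp g h := by simp [p.iso_comp]

/-- The functor `f ↦ f ≫ p`. -/
@[simps]
def whiskering (p : PseudoCone A L) (X : H) : (X ⟶ L) ⥤ PseudoCone A X where
  obj f := p.whisker f
  map {f f'} η :=
    { app := fun c => η ▷ p.leg c
      naturality := fun {c d} g => by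
        change ((α_ f (p.leg c) (A.map g)).hom ≫ f ◁ (p.iso g).hom) ≫ η ▷ p.leg d =
          (η ▷ p.leg c) ▷ A.map g ≫ (α_ f' (p.leg c) (A.map g)).hom ≫ f' ◁ (p.iso g).hom
        rw [Category.assoc, whisker_exchange]
        simp }

/-- Whiskering functors of isomorphic pseudocones are isomorphic. -/
def whiskeringIso {p q : PseudoCone A L} (e : p ≅ q) (X : H) :
    p.whiskering X ≅ q.whiskering X :=
  NatIso.ofComponents
    (fun f => isoMk (fun c => whiskerLeftIso f (isoApp e c)) (fun {c d} g => by
      change ((α_ f (p.leg c) (A.map g)).hom ≫ f ◁ (p.iso g).hom) ≫ f ◁ Hom.app e.hom d =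
        (f ◁ Hom.app e.hom c) ▷ A.map g ≫ (α_ f (q.leg c) (A.map g)).hom ≫ f ◁ (q.iso g).hom
      rw [Category.assoc, ← whiskerLeft_comp, e.hom.naturality]
      simp))
    (fun {f f'} η => by
      ext c
      exact (whisker_exchange η (Hom.app e.hom c)).symm)

/-- The universal property of a conical bilimit, for an unpacked pseudocone. -/
def IsUniversal (p : PseudoCone A L) : Prop :=
  ∀ X : H, (p.whiskering X).IsEquivalence

end PseudoCone

/-- The isomorphism of `1`-cells in `Cat` given by a natural isomorphism. -/
def catIso {K K' : Cat.{w, v}} {F G : K ⟶ K'} (e : F.toFunctor ≅ G.toFunctor) : F ≅ G :=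
  Cat.Hom.isoMk e

lemma congr_natTrans_app {K K' : Cat.{w, v}} {F G : K ⟶ K'} {p q : F ⟶ G} (h : p = q) (x : K) :
    p.toNatTrans.app x = q.toNatTrans.app x := by rw [h]

/-- A constructor for pseudonatural transformations between pseudofunctors on a locally discrete
bicategory. -/
def strongTransMk {K : Type*} [Bicategory K] [IsLocallyDiscrete K] {D : Type*} [Bicategory D]
    {F G : K ⥤ᵖ D} (app : ∀ a, F.obj a ⟶ G.obj a)
    (naturality : ∀ {a b} (f : a ⟶ b), F.map f ≫ app b ≅ app a ≫ G.map f)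
    (naturality_id : ∀ a, (naturality (𝟙 a)).hom ≫ app a ◁ (G.mapId a).hom =
        (F.mapId a).hom ▷ app a ≫ (λ_ (app a)).hom ≫ (ρ_ (app a)).inv)
    (naturality_comp : ∀ {a b c} (f : a ⟶ b) (g : b ⟶ c),
      (naturality (f ≫ g)).hom ≫ app a ◁ (G.mapComp f g).hom =
        (F.mapComp f g).hom ▷ app c ≫ (α_ _ _ _).hom ≫ F.map f ◁ (naturality g).hom ≫
        (α_ _ _ _).inv ≫ (naturality f).hom ▷ G.map g ≫ (α_ _ _ _).hom) :
    F ⟶ G where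
  app := app
  naturality := naturality
  naturality_naturality {a b f g} η := by
    obtain rfl := obj_ext_of_isDiscrete η
    obtain rfl : η = 𝟙 f := Subsingleton.elim _ _
    simp
  naturality_id := naturality_id
  naturality_comp := naturality_comp

section ConstTrans

variable [IsLocallyDiscrete K] {A : K ⥤ᵖ H} {X L : H} (W : K ⥤ᵖ Cat.{w, v})

/-- A pseudocone as a pseudonatural transformation `W ⟶ H(X, A -)` with constant components. -/
def constTrans (p : PseudoCone A X) : W ⟶ A.comp (homFrom X) :=
  strongTransMk (fun c => ⟨(Functor.const (W.obj c)).obj (p.leg c)⟩)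
    (fun f => catIso (NatIso.ofComponents (fun _ => (p.iso f).symm) (fun _ => by
      change 𝟙 (p.leg _) ≫ (p.iso f).inv = (p.iso f).inv ≫ 𝟙 (p.leg _) ▷ A.map f
      simp)))
    (fun a => cat_hom₂_ext fun x => by
      change (p.iso (𝟙 a)).inv ≫ p.leg a ◁ (A.mapId a).hom ≫ (ρ_ (p.leg a)).hom =
        𝟙 _ ≫ 𝟙 _ ≫ 𝟙 _
      rw [Iso.inv_comp_eq, p.iso_id]
      simp)
    (fun {a b c} f g => cat_hom₂_ext fun x => by
      change (p.iso (f ≫ g)).inv ≫ p.leg a ◁ (A.mapComp f g).hom ≫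
          (α_ (p.leg a) (A.map f) (A.map g)).inv =
        𝟙 _ ≫ 𝟙 _ ≫ (p.iso g).inv ≫ 𝟙 _ ≫ (p.iso f).inv ▷ A.map g ≫ 𝟙 _
      rw [Iso.inv_comp_eq, p.iso_comp]
      simp)

/-- The functor `PseudoCone A X ⥤ [C, Cat](W, H(X, A -))` sending a pseudocone to the
transformation with constant components at its legs. -/
def constTransFunctor (A : K ⥤ᵖ H) (X : H) :
    PseudoCone A X ⥤ (W ⟶ A.comp (homFrom X)) where
  obj p := constTrans W p
  map {p q} Γ := ⟨{
    app := fun c => ⟨(Functor.const (W.obj c)).map (PseudoCone.Hom.app Γ c)⟩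
    naturality := fun {a b} f => cat_hom₂_ext fun x => by
      change PseudoCone.Hom.app Γ b ≫ (q.iso f).inv =
        (p.iso f).inv ≫ PseudoCone.Hom.app Γ a ▷ A.map f
      rw [Iso.comp_inv_eq, Category.assoc, Iso.eq_inv_comp]
      exact Γ.naturality f }⟩
  map_id p := rfl
  map_comp Γ Θ := rfl

/-- Whiskering pseudocones corresponds to the comparison functor of weighted bilimits. -/
def constTransCompIso (p : PseudoCone A L) (X : H) :
    p.whiskering X ⋙ constTransFunctor W A X ≅ bilimitComparison W A L (constTrans W p) X :=
  NatIso.ofComponents (fun f => Pseudofunctor.StrongTrans.isoMk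
    (fun c => catIso (NatIso.ofComponents (fun x => Iso.refl _) (fun _ => by
      change 𝟙 _ ≫ 𝟙 _ = 𝟙 _ ≫ f ◁ 𝟙 _
      simp)))
    (fun {a b} g => cat_hom₂_ext fun x => by
      change 𝟙 _ ≫ 𝟙 _ ≫ f ◁ (p.iso g).inv ≫ 𝟙 _ ≫ (α_ f (p.leg a) (A.map g)).inv ≫ 𝟙 _ =
        (f ◁ (p.iso g).inv ≫ (α_ f (p.leg a) (A.map g)).inv) ≫ 𝟙 _ ▷ _
      simp))
    (fun {f g} η => Pseudofunctor.StrongTrans.homCategory.ext fun c => cat_hom₂_ext fun x => by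
      change η ▷ p.leg c ≫ 𝟙 _ = 𝟙 _ ≫ η ▷ p.leg c
      simp)

end ConstTrans

/-! ### Components of transformations into `H(X, A -)` -/

section Components

variable {A : K ⥤ᵖ H} {X : H} {W : K ⥤ᵖ Cat.{w, v}} (α : W ⟶ A.comp (homFrom X))

/-- The component at `c` of a transformation `W ⟶ H(X, A -)`, as a functor `W c ⥤ H(X, A c)`. -/
def compFunctor (c : K) : W.obj c ⥤ (X ⟶ A.obj c) := (α.app c).toFunctor

/-- The naturality isomorphism of a transformation `W ⟶ H(X, A -)` at an object of `W c`. -/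
def compNat {c d : K} (f : c ⟶ d) (x : W.obj c) :
    (compFunctor α d).obj ((W.map f).toFunctor.obj x) ≅ (compFunctor α c).obj x ≫ A.map f :=
  (Cat.Hom.toNatIso (α.naturality f)).app x

lemma compNat_natural {c d : K} (f : c ⟶ d) {x y : W.obj c} (u : x ⟶ y) :
    (compFunctor α d).map ((W.map f).toFunctor.map u) ≫ (compNat α f y).hom =
      (compNat α f x).hom ≫ (compFunctor α c).map u ▷ A.map f :=
  (α.naturality f).hom.toNatTrans.naturality u

lemma compNat_id (c : K) (x : W.obj c) (u : (W.map (𝟙 c)).toFunctor.obj x ⟶ x)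
    (hu : u = (W.mapId c).hom.toNatTrans.app x) :
    (compNat α (𝟙 c) x).hom ≫ (compFunctor α c).obj x ◁ (A.mapId c).hom ≫
      (ρ_ ((compFunctor α c).obj x)).hom = (compFunctor α c).map u := by
  have h : (compNat α (𝟙 c) x).hom ≫ (compFunctor α c).obj x ◁ (A.mapId c).hom ≫
      (ρ_ ((compFunctor α c).obj x)).hom =
      (compFunctor α c).map ((W.mapId c).hom.toNatTrans.app x) ≫ 𝟙 _ ≫ 𝟙 _ :=
    congr_natTrans_app (α.naturality_id c) x
  rw [h, hu]
  exact (congrArg _ (Category.comp_id _)).trans (Category.comp_id _)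

lemma compNat_comp {c d e : K} (f : c ⟶ d) (g : d ⟶ e) (x : W.obj c)
    (u : (W.map (f ≫ g)).toFunctor.obj x ⟶
      (W.map g).toFunctor.obj ((W.map f).toFunctor.obj x))
    (hu : u = (W.mapComp f g).hom.toNatTrans.app x) :
    (compNat α (f ≫ g) x).hom ≫ (compFunctor α c).obj x ◁ (A.mapComp f g).hom ≫
          (α_ ((compFunctor α c).obj x) (A.map f) (A.map g)).inv =
      (compFunctor α e).map u ≫ (compNat α g ((W.map f).toFunctor.obj x)).hom ≫
          (compNat α f x).hom ▷ A.map g := by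
  have h : (compNat α (f ≫ g) x).hom ≫ (compFunctor α c).obj x ◁ (A.mapComp f g).hom ≫
          (α_ ((compFunctor α c).obj x) (A.map f) (A.map g)).inv =
      (compFunctor α e).map u ≫ 𝟙 _ ≫ (compNat α g ((W.map f).toFunctor.obj x)).hom ≫ 𝟙 _ ≫
          (compNat α f x).hom ▷ A.map g ≫ 𝟙 _ := by
    subst hu
    exact congr_natTrans_app (α.naturality_comp f g) x
  simpa using h

/-- The component of a modification between transformations `W ⟶ H(X, A -)`. -/
def modApp {α β : W ⟶ A.comp (homFrom X)} (Γ : α ⟶ β) (c : K) :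
    compFunctor α c ⟶ compFunctor β c := (Γ.as.app c).toNatTrans

lemma modApp_natural {α β : W ⟶ A.comp (homFrom X)} (Γ : α ⟶ β) {c d : K} (f : c ⟶ d)
    (x : W.obj c) :
    (modApp Γ d).app ((W.map f).toFunctor.obj x) ≫ (compNat β f x).hom =
      (compNat α f x).hom ≫ (modApp Γ c).app x ▷ A.map f :=
  congr_natTrans_app (Γ.as.naturality f) x

lemma mod_ext {α β : W ⟶ A.comp (homFrom X)} {Γ Θ : α ⟶ β}
    (h : ∀ (c : K) (x : W.obj c), (modApp Γ c).app x = (modApp Θ c).app x) : Γ = Θ :=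
  Pseudofunctor.StrongTrans.homCategory.ext fun c => cat_hom₂_ext fun x => h c x

/-- A constructor for invertible modifications between transformations `W ⟶ H(X, A -)`. -/
def modIsoMk {α β : W ⟶ A.comp (homFrom X)} (app : ∀ c, compFunctor α c ≅ compFunctor β c)
    (natural : ∀ {c d : K} (f : c ⟶ d) (x : W.obj c),
      (app d).hom.app ((W.map f).toFunctor.obj x) ≫ (compNat β f x).hom =
        (compNat α f x).hom ≫ (app c).hom.app x ▷ A.map f) : α ≅ β :=
  Pseudofunctor.StrongTrans.isoMk (fun c => catIso (app c))
    (fun f => cat_hom₂_ext fun x => natural f x)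

end Components

/-! ### Contractible weights -/

/-- A weight is contractible if all of its values are equivalent to the terminal category, i.e. are
nonempty with exactly one morphism between any two objects. -/
structure IsContractible {B : Type*} [Bicategory B] (W : B ⥤ᵖ Cat.{w, v}) : Prop where
  nonempty (c : B) : Nonempty (W.obj c)
  hom_nonempty {c : B} (x y : W.obj c) : Nonempty (x ⟶ y)
  hom_subsingleton {c : B} (x y : W.obj c) : Subsingleton (x ⟶ y)

namespace IsContractible

variable {A : K ⥤ᵖ H} {X : H} {W : K ⥤ᵖ Cat.{w, v}} (hW : IsContractible W)

/-- The isomorphism between two objects of a value of a contractible weight. -/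
noncomputable def iso (hW : IsContractible W) {c : K} (x y : W.obj c) : x ≅ y where
  hom := (hW.hom_nonempty x y).some
  inv := (hW.hom_nonempty y x).some
  hom_inv_id := (hW.hom_subsingleton _ _).elim _ _
  inv_hom_id := (hW.hom_subsingleton _ _).elim _ _

lemma hom_eq (hW : IsContractible W) {c : K} {x y : W.obj c} (f g : x ⟶ y) : f = g :=
  (hW.hom_subsingleton _ _).elim _ _

/-- A chosen object of a value of a contractible weight. -/
noncomputable def pt (c : K) : W.obj c := (hW.nonempty c).some

variable (α : W ⟶ A.comp (homFrom X))

/-- The pseudocone obtained from a pseudonatural transformation on a contractible weight, by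
evaluation at chosen objects. -/
noncomputable def toPseudoCone : PseudoCone A X where
  leg c := (compFunctor α c).obj (hW.pt c)
  iso {c d} f := (compNat α f (hW.pt c)).symm ≪≫
    (compFunctor α d).mapIso (hW.iso ((W.map f).toFunctor.obj (hW.pt c)) (hW.pt d))
  iso_id c := by
    rw [Iso.trans_hom, Iso.symm_hom, Iso.inv_comp_eq]
    exact (compNat_id α c _ _ (hW.hom_eq _ _)).symm
  iso_comp {c d e} f g := by
    have h := compNat_comp α f g (hW.pt c) (hW.iso _ _).hom (hW.hom_eq _ _)
    have h' := compNat_natural α g (hW.iso ((W.map f).toFunctor.obj (hW.pt c)) (hW.pt d)).hom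
    have e : (hW.iso ((W.map (f ≫ g)).toFunctor.obj (hW.pt c)) (hW.pt e)).hom =
      (hW.iso _ _).hom ≫ (W.map g).toFunctor.map
        (hW.iso ((W.map f).toFunctor.obj (hW.pt c)) (hW.pt d)).hom ≫ (hW.iso _ _).hom :=
      hW.hom_eq _ _
    rw [Iso.trans_hom, Iso.symm_hom, Iso.inv_comp_eq]
    simp only [Functor.mapIso_hom, Iso.trans_hom, Iso.symm_hom, comp_whiskerRight, Category.assoc]
    rw [← Category.assoc ((compFunctor α c).obj (hW.pt c) ◁ (A.mapComp f g).hom),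
      ← Category.assoc (compNat α (f ≫ g) (hW.pt c)).hom, h, e, Functor.map_comp, Functor.map_comp]
    simp only [Category.assoc]
    rw [hom_inv_whiskerRight_assoc, ← Category.assoc (compNat α g _).hom, ← h']
    simp

variable [IsLocallyDiscrete K]

/-- A transformation on a contractible weight is isomorphic to one with constant components. -/
noncomputable def constTransToPseudoConeIso : constTrans W (hW.toPseudoCone α) ≅ α :=
  modIsoMk
    (fun c => NatIso.ofComponents
      (fun x => (compFunctor α c).mapIso (hW.iso (hW.pt c) x)) (fun {x y} u => by
        change 𝟙 _ ≫ (compFunctor α c).map _ = (compFunctor α c).map _ ≫ (compFunctor α c).map u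
        rw [Category.id_comp, ← Functor.map_comp]
        exact congrArg _ (hW.hom_eq _ _)))
    (fun {c d} f x => by
      change (compFunctor α d).map (hW.iso (hW.pt d) ((W.map f).toFunctor.obj x)).hom ≫
          (compNat α f x).hom =
        ((compFunctor α d).map (hW.iso _ _).inv ≫ (compNat α f (hW.pt c)).hom) ≫
          (compFunctor α c).map (hW.iso (hW.pt c) x).hom ▷ A.map f
      rw [Category.assoc, ← compNat_natural, ← Category.assoc, ← Functor.map_comp]
      exact congrArg (fun u => (compFunctor α d).map u ≫ _) (hW.hom_eq _ _))

/-- For a contractible weight `W`, pseudocones are the same as transformations `W ⟶ H(X, A -)`: a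
modification between transformations with constant components has constant components itself,
since any two objects of a value of `W` are connected by a morphism. -/
lemma isEquivalence_constTransFunctor (hW : IsContractible W) (A : K ⥤ᵖ H) (X : H) :
    (constTransFunctor W A X).IsEquivalence where
  faithful := ⟨fun {p q Γ Θ} h => PseudoCone.hom_ext fun c =>
    congrArg (fun m => (modApp m c).app (hW.pt c)) h⟩
  full := ⟨fun {p q} Γ => by
    have key (c : K) (x y : W.obj c) : (modApp Γ c).app x = (modApp Γ c).app y := by
      have h := (modApp Γ c).naturality (hW.iso x y).hom
      exact (Category.comp_id _).symm.trans (h.symm.trans (Category.id_comp _))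
    refine ⟨{ app := fun c => (modApp Γ c).app (hW.pt c), naturality := fun {c d} f => ?_ }, ?_⟩
    · have h := modApp_natural Γ f (hW.pt c)
      rw [key d _ (hW.pt d)] at h
      have aux (s : p.leg d ⟶ q.leg d) (t : p.leg c ⟶ q.leg c)
          (h : s ≫ (q.iso f).inv = (p.iso f).inv ≫ t ▷ A.map f) :
          (p.iso f).hom ≫ s = t ▷ A.map f ≫ (q.iso f).hom := by
        rwa [Iso.comp_inv_eq, Category.assoc, Iso.eq_inv_comp] at h
      exact aux _ _ h
    · exact mod_ext fun c x => key c _ _⟩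
  essSurj := ⟨fun α => ⟨hW.toPseudoCone α, ⟨hW.constTransToPseudoConeIso α⟩⟩⟩

end IsContractible

/-- Comparison functors for isomorphic transformations are isomorphic. -/
def bilimitComparisonIso (W : K ⥤ᵖ Cat.{w, v}) (A : K ⥤ᵖ H) (L : H)
    {r r' : W ⟶ A.comp (homFrom L)} (e : r ≅ r') (X : H) :
    bilimitComparison W A L r X ≅ bilimitComparison W A L r' X :=
  Functor.isoWhiskerLeft _ (Functor.isoWhiskerLeft _ ((precomposing W _ _).mapIso e))

/-- Bilimits weighted by a contractible weight are the vertices of universal pseudocones. -/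
lemma isWeightedBilimit_iff_of_isContractible [IsLocallyDiscrete K] {W : K ⥤ᵖ Cat.{w, v}}
    (hW : IsContractible W) (A : K ⥤ᵖ H) (L : H) :
    IsWeightedBilimit W A L ↔ ∃ p : PseudoCone A L, p.IsUniversal := by
  have := hW.isEquivalence_constTransFunctor A
  have key (p : PseudoCone A L) (X : H) : (p.whiskering X).IsEquivalence ↔
      (bilimitComparison W A L (constTrans W p) X).IsEquivalence := by
    rw [← Functor.isEquivalence_iff_of_iso (constTransCompIso W p X)]
    exact ⟨fun _ => inferInstance,
      fun _ => Functor.isEquivalence_of_comp_right _ (constTransFunctor W A X)⟩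
  constructor
  · rintro ⟨r, hr⟩
    refine ⟨hW.toPseudoCone r, fun X => (key _ X).2 ?_⟩
    exact (Functor.isEquivalence_iff_of_iso
      (bilimitComparisonIso W A L (hW.constTransToPseudoConeIso r) X)).2 (hr X)
  · rintro ⟨p, hp⟩
    exact ⟨constTrans W p, fun X => (key p X).1 (hp X)⟩

end PseudoCones

/-! ### Examples of contractible weights -/

section ContractibleWeights

lemma isContractible_weight {C : Type*} [Category C] (F : C ⥤ Cat.{0, 0})
    (h₁ : ∀ c, Nonempty (F.obj c)) (h₂ : ∀ (c) (x y : F.obj c), Nonempty (x ⟶ y))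
    (h₃ : ∀ (c) (x y : F.obj c), Subsingleton (x ⟶ y)) :
    IsContractible (weight.{w, v} F) where
  nonempty c := ⟨show ULiftHom.{w} (ULift.{v} (F.obj c.as)) from ⟨(h₁ c.as).some⟩⟩
  hom_nonempty {c} x y :=
    ⟨(⟨(h₂ c.as (ULift.down x) (ULift.down y)).some⟩ : ULift (ULift.down x ⟶ ULift.down y))⟩
  hom_subsingleton {c} x y :=
    ⟨fun f g => ULift.ext (α := (ULift.down x : F.obj c.as) ⟶ ULift.down y) f g
      ((h₃ c.as _ _).elim _ _)⟩

lemma isContractible_terminalWeight (C : Type*) [Category C] :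
    IsContractible (terminalWeight.{w, v} C) :=
  isContractible_weight _ (fun _ => ⟨⟨⟨⟩⟩⟩) (fun _ _ _ => ⟨Discrete.eqToHom rfl⟩)
    (fun _ x y => inferInstanceAs (Subsingleton (Discrete.mk x.as ⟶ Discrete.mk y.as)))

lemma isContractible_representableWeight_zeroOrdinal :
    IsContractible (representableWeight.{w, v} j zeroOrdinal) :=
  isContractible_weight _ (fun _ => ⟨⟨Limits.IsInitial.to WithInitial.starInitial _⟩⟩)
    (fun _ (_ _ : Discrete (zeroOrdinal ⟶ j.obj _)) =>
      ⟨Discrete.eqToHom (WithInitial.starInitial.hom_ext _ _)⟩)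
    (fun _ _ _ => inferInstanceAs (Subsingleton (Discrete.mk _ ⟶ Discrete.mk _)))

/-- In the localization of a category with an initial object at all of its morphisms, the images
of the morphisms out of the initial object form a contraction onto this object. -/
noncomputable def localizationContraction {K : Type*} [Category K] {i : K}
    (hi : Limits.IsInitial i) :
    (Functor.const _).obj ((⊤ : MorphismProperty K).Q.obj i) ⟶
      𝟭 ((⊤ : MorphismProperty K).Localization) :=
  Localization.Construction.natTransExtension
    { app := fun x => (⊤ : MorphismProperty K).Q.map (hi.to x)
      naturality := fun x y f => by
        refine (Category.id_comp _).trans ?_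
        change _ = (⊤ : MorphismProperty K).Q.map _ ≫ (⊤ : MorphismProperty K).Q.map f
        rw [← Functor.map_comp, hi.hom_ext (hi.to y) (hi.to x ≫ f)] }

instance {K : Type*} [Category K] {i : K} (hi : Limits.IsInitial i)
    (x : (⊤ : MorphismProperty K).Localization) : IsIso ((localizationContraction hi).app x) := by
  obtain ⟨y, rfl⟩ := (Localization.Construction.objEquiv _).surjective x
  have h : (localizationContraction hi).app ((⊤ : MorphismProperty K).Q.obj y) =
      (⊤ : MorphismProperty K).Q.map (hi.to y) :=
    Localization.Construction.NatTransExtension.app_eq _ y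
  change IsIso ((localizationContraction hi).app ((⊤ : MorphismProperty K).Q.obj y))
  rw [h]
  exact (⊤ : MorphismProperty K).Q_inverts _ trivial

/-- The ordinal `n + 1`, as a category, has an initial object. -/
def isInitialZero (n : ℕ) : Limits.IsInitial (0 : Fin (n + 1)) :=
  Limits.IsInitial.ofUniqueHom (fun x => homOfLE (Fin.zero_le x)) fun _ _ => Subsingleton.elim _ _

/-- The values of the descent weight are contractible: by naturality of the contraction onto the
initial object, which is invertible, there is exactly one morphism between any two objects. -/
lemma isContractible_descentWeight : IsContractible descentWeight.{w, v} := by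
  have key (n : ℕ) (x y : (⊤ : MorphismProperty (Fin (n + 1))).Localization) (f : x ⟶ y) :
      f = inv ((localizationContraction (isInitialZero n)).app x) ≫
        (localizationContraction (isInitialZero n)).app y := by
    rw [IsIso.eq_inv_comp]
    exact ((localizationContraction (isInitialZero n)).naturality f).symm.trans
      (Category.id_comp _)
  have ex (n : ℕ) (x y : (⊤ : MorphismProperty (Fin (n + 1))).Localization) :
      Nonempty (x ⟶ y) :=
    ⟨inv ((localizationContraction (isInitialZero n)).app x) ≫
      (localizationContraction (isInitialZero n)).app y⟩
  refine isContractible_weight _ (fun c => ?_) (fun c x y => ?_) (fun c x y => ?_)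
  · exact ⟨(⊤ : MorphismProperty (Fin ((t3.obj c).len + 1))).Q.obj 0⟩
  · exact ex _ x y
  · exact ⟨fun f g => (key _ x y f).trans (key _ x y g).symm⟩

end ContractibleWeights

/-! ### The total category of generalized elements -/

section Total

universe w₁ v₁ u₁

variable {K : Type u₁} [Bicategory.{w₁, v₁} K] {H : Type u} [Bicategory.{w, v} H]

/-- The total category (Grothendieck construction) of `H(X, A -)`: its objects are the pairs of an
object `c` and a `1`-cell `X ⟶ A c`. -/
structure Total (A : K ⥤ᵖ H) (X : H) where
  /-- The object of the base. -/
  base : K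
  /-- The generalized element. -/
  obj : X ⟶ A.obj base

namespace Total

variable {A : K ⥤ᵖ H} {X : H}

/-- A morphism of the total category: a morphism `f` of the base and a `2`-cell from the image
under `A f` of the source to the target. -/
structure Hom (p q : Total A X) where
  /-- The underlying morphism of the base. -/
  base : p.base ⟶ q.base
  /-- The `2`-cell. -/
  fiber : p.obj ≫ A.map base ⟶ q.obj

@[simps]
instance : CategoryStruct (Total A X) where
  Hom := Hom
  id p := ⟨𝟙 p.base, p.obj ◁ (A.mapId p.base).hom ≫ (ρ_ p.obj).hom⟩
  comp {p _ _} f g := ⟨f.base ≫ g.base, p.obj ◁ (A.mapComp f.base g.base).hom ≫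
    (α_ p.obj (A.map f.base) (A.map g.base)).inv ≫ f.fiber ▷ A.map g.base ≫ g.fiber⟩

/-- The constructor of morphisms of the total category. -/
abbrev mkHom {p q : Total A X} (f : p.base ⟶ q.base) (φ : p.obj ≫ A.map f ⟶ q.obj) : p ⟶ q :=
  ⟨f, φ⟩

lemma mk_inj {p q : Total A X} {f : p.base ⟶ q.base} {φ ψ : p.obj ≫ A.map f ⟶ q.obj}
    (h : (⟨f, φ⟩ : p ⟶ q) = ⟨f, ψ⟩) : φ = ψ := by
  injection h

lemma exists_eq_mk {p q : Total A X} (k : p ⟶ q) {g : p.base ⟶ q.base} (h : k.base = g) :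
    ∃ φ : p.obj ≫ A.map g ⟶ q.obj, k = ⟨g, φ⟩ := by
  subst h
  exact ⟨k.fiber, rfl⟩

variable [IsLocallyDiscrete K]

/-- Morphisms of the total category over equal morphisms of the base are equal if their `2`-cells
correspond; the equality in the base is witnessed by a `2`-cell `η`. -/
lemma hom_ext {p q : Total A X} {f g : p ⟶ q} (η : f.base ⟶ g.base)
    (h : f.fiber = p.obj ◁ A.map₂ η ≫ g.fiber) : f = g := by
  obtain ⟨f, φ⟩ := f
  obtain ⟨g, ψ⟩ := g
  obtain rfl : f = g := obj_ext_of_isDiscrete η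
  obtain rfl : η = 𝟙 f := Subsingleton.elim _ _
  obtain rfl : φ = ψ := by simpa using h
  rfl

instance : Category (Total A X) where
  id_comp {p q} f := hom_ext (λ_ f.base).hom (by simp)
  comp_id {p q} f := hom_ext (ρ_ f.base).hom (by
    simp [← whisker_exchange_assoc])
  assoc {p q r s} f g h := hom_ext (α_ f.base g.base h.base).hom (by
    simp [← whisker_exchange_assoc])

/-- The cocartesian morphisms of the total category: those with invertible `2`-cell. -/
def IsCocart {p q : Total A X} (f : p ⟶ q) : Prop := IsIso f.fiber

lemma IsCocart.comp {p q r : Total A X} {f : p ⟶ q} {g : q ⟶ r} (hf : IsCocart f)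
    (hg : IsCocart g) : IsCocart (f ≫ g) := by
  unfold IsCocart at *
  dsimp
  infer_instance

lemma IsCocart.of_comp {p q r : Total A X} {f : p ⟶ q} {g : q ⟶ r} (hf : IsCocart f)
    (hg : IsCocart (f ≫ g)) : IsCocart g := by
  unfold IsCocart at *
  dsimp at hg
  rw [isIso_comp_left_iff, isIso_comp_left_iff, isIso_comp_left_iff] at hg
  exact hg

/-- Cocartesian morphisms admit factorizations over given factorizations in the base. -/
lemma IsCocart.exists_fac {p q r : Total A X} {f : p ⟶ q} (hf : IsCocart f) (h : p ⟶ r)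
    (g : q.base ⟶ r.base) (w : f.base ≫ g = h.base) :
    ∃ φ : q.obj ≫ A.map g ⟶ r.obj, f ≫ ⟨g, φ⟩ = h := by
  obtain ⟨h, ψ⟩ := h
  subst w
  unfold IsCocart at hf
  refine ⟨inv (p.obj ◁ (A.mapComp f.base g).hom ≫
    (α_ p.obj (A.map f.base) (A.map g)).inv ≫ f.fiber ▷ A.map g) ≫ ψ, ?_⟩
  refine congrArg (Hom.mk _) ?_
  simp

/-- Factorizations through cocartesian morphisms are unique. -/
lemma IsCocart.cancel {p q r : Total A X} {f : p ⟶ q} (hf : IsCocart f) {k k' : q ⟶ r}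
    (hb : k.base = k'.base) (w : f ≫ k = f ≫ k') : k = k' := by
  obtain ⟨k, φ⟩ := k
  obtain ⟨k', φ'⟩ := k'
  obtain rfl : k = k' := hb
  unfold IsCocart at hf
  have := mk_inj w
  rw [cancel_epi, cancel_epi, cancel_epi] at this
  obtain rfl : φ = φ' := this
  rfl

/-- The vertical morphism of the total category given by a `2`-cell. -/
def vert {c : K} {x y : X ⟶ A.obj c} (u : x ⟶ y) : (⟨c, x⟩ : Total A X) ⟶ ⟨c, y⟩ :=
  ⟨𝟙 c, x ◁ (A.mapId c).hom ≫ (ρ_ x).hom ≫ u⟩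

lemma comp_vert {p : Total A X} {c : K} {x y : X ⟶ A.obj c} (f : p.base ⟶ c)
    (φ : p.obj ≫ A.map f ⟶ x) (u : x ⟶ y) :
    (show p ⟶ ⟨c, x⟩ from ⟨f, φ⟩) ≫ vert u = ⟨f, φ ≫ u⟩ :=
  hom_ext (ρ_ f).hom (by simp [vert, ← whisker_exchange_assoc])

lemma vert_comp {q : Total A X} {c : K} {x y : X ⟶ A.obj c} (u : x ⟶ y) (f : c ⟶ q.base)
    (φ : y ≫ A.map f ⟶ q.obj) :
    vert u ≫ (show (⟨c, y⟩ : Total A X) ⟶ q from ⟨f, φ⟩) = ⟨f, u ▷ A.map f ≫ φ⟩ :=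
  hom_ext (λ_ f).hom (by simp [vert])

lemma vert_injective {c : K} {x y : X ⟶ A.obj c} {u u' : x ⟶ y}
    (h : (vert u : (⟨c, x⟩ : Total A X) ⟶ ⟨c, y⟩) = vert u') : u = u' := by
  have := mk_inj h
  rwa [cancel_epi, cancel_epi] at this

lemma exists_eq_vert {c : K} {x y : X ⟶ A.obj c} (k : (⟨c, x⟩ : Total A X) ⟶ ⟨c, y⟩)
    (h : k.base = 𝟙 c) : ∃ u : x ⟶ y, k = vert u := by
  obtain ⟨φ, rfl⟩ := exists_eq_mk k h
  refine ⟨(ρ_ x).inv ≫ x ◁ (A.mapId c).inv ≫ φ, congrArg (Hom.mk _) ?_⟩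
  simp

lemma isIso_of_isCocart_vert {c : K} {x y : X ⟶ A.obj c} {u : x ⟶ y}
    (h : IsCocart (vert u : (⟨c, x⟩ : Total A X) ⟶ ⟨c, y⟩)) : IsIso u := by
  unfold IsCocart vert at h
  rw [isIso_comp_left_iff, isIso_comp_left_iff] at h
  exact h

end Total

namespace PseudoCone

variable {A : K ⥤ᵖ H} {X : H} (p : PseudoCone A X)

/-- A leg of a pseudocone, as an object of the total category. -/
abbrev el (c : K) : Total A X := ⟨c, p.leg c⟩

/-- A filler of a triangle of a pseudocone, as a morphism of the total category. -/
def tr {c d : K} (f : c ⟶ d) : p.el c ⟶ p.el d := ⟨f, (p.iso f).hom⟩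

lemma tr_id (c : K) : p.tr (𝟙 c) = 𝟙 (p.el c) := congrArg (Total.Hom.mk _) (p.iso_id c)

lemma tr_comp {c d e : K} (f : c ⟶ d) (g : d ⟶ e) : p.tr (f ≫ g) = p.tr f ≫ p.tr g :=
  congrArg (Total.Hom.mk _) (p.iso_comp f g)

variable [IsLocallyDiscrete K]

lemma isCocart_tr {c d : K} (f : c ⟶ d) : Total.IsCocart (p.tr f) :=
  inferInstanceAs (IsIso (p.iso f).hom)

lemma iso_hom_eq {c d : K} {f g : c ⟶ d} (η : f ⟶ g) :
    (p.iso f).hom = p.leg c ◁ A.map₂ η ≫ (p.iso g).hom := by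
  obtain rfl := obj_ext_of_isDiscrete η
  obtain rfl : η = 𝟙 f := Subsingleton.elim _ _
  simp

/-- A pseudocone is a cocartesian section of the total category. -/
noncomputable def ofTotal (leg : ∀ c, X ⟶ A.obj c)
    (φ : ∀ {c d : K} (f : c ⟶ d), leg c ≫ A.map f ⟶ leg d)
    (isCocart : ∀ {c d : K} (f : c ⟶ d), IsIso (φ f))
    (tr_id : ∀ c, Total.mkHom (p := ⟨c, leg c⟩) (q := ⟨c, leg c⟩) (𝟙 c) (φ (𝟙 c)) = 𝟙 _)
    (tr_comp : ∀ {c d e : K} (f : c ⟶ d) (g : d ⟶ e),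
      Total.mkHom (p := ⟨c, leg c⟩) (q := ⟨e, leg e⟩) (f ≫ g) (φ (f ≫ g)) =
        Total.mkHom (p := ⟨c, leg c⟩) (q := ⟨d, leg d⟩) f (φ f) ≫
          Total.mkHom (p := ⟨d, leg d⟩) (q := ⟨e, leg e⟩) g (φ g)) : PseudoCone A X where
  leg := leg
  iso f := @asIso _ _ _ _ (φ f) (isCocart f)
  iso_id c := Total.mk_inj (tr_id c)
  iso_comp f g := Total.mk_inj (tr_comp f g)

/-- The compatibility of `2`-cells between legs with the fillers of triangles is the commutativity
of a square in the total category. -/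
lemma naturality_iff_total {p q : PseudoCone A X} {c d : K} (f : c ⟶ d) (u : p.leg c ⟶ q.leg c)
    (u' : p.leg d ⟶ q.leg d) :
    (p.iso f).hom ≫ u' = u ▷ A.map f ≫ (q.iso f).hom ↔
      p.tr f ≫ Total.vert u' = Total.vert u ≫ q.tr f := by
  have h₁ : p.tr f ≫ Total.vert u' = ⟨f, (p.iso f).hom ≫ u'⟩ := Total.comp_vert _ _ _
  have h₂ : Total.vert u ≫ q.tr f = ⟨f, u ▷ A.map f ≫ (q.iso f).hom⟩ := Total.vert_comp _ _ _
  rw [h₁, h₂]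
  exact ⟨fun h => congrArg _ h, Total.mk_inj⟩

universe w₂ v₂ u₂

variable {K' : Type u₂} [Bicategory.{w₂, v₂} K'] (T : K' ⥤ᵖ K)

/-- The restriction of a pseudocone along a pseudofunctor. -/
@[simps]
def restrict : PseudoCone (T.comp A) X where
  leg c := p.leg (T.obj c)
  iso f := p.iso (T.map f)
  iso_id c := by
    rw [p.iso_hom_eq (T.mapId c).hom, p.iso_id]
    change _ = p.leg (T.obj c) ◁ (A.map₂ (T.mapId c).hom ≫ (A.mapId (T.obj c)).hom) ≫
      (ρ_ (p.leg (T.obj c))).hom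
    rw [whiskerLeft_comp, Category.assoc]
  iso_comp {c d e} f g := by
    rw [p.iso_hom_eq (T.mapComp f g).hom, p.iso_comp]
    change _ = p.leg (T.obj c) ◁ (A.map₂ (T.mapComp f g).hom ≫
      (A.mapComp (T.map f) (T.map g)).hom) ≫ (α_ _ (A.map (T.map f)) (A.map (T.map g))).inv ≫
        (p.iso (T.map f)).hom ▷ A.map (T.map g) ≫ (p.iso (T.map g)).hom
    rw [whiskerLeft_comp, Category.assoc]

/-- The functor restricting pseudocones along a pseudofunctor. -/
def restriction (A : K ⥤ᵖ H) (X : H) : PseudoCone A X ⥤ PseudoCone (T.comp A) X where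
  obj p := p.restrict T
  map Γ := { app := fun c => Hom.app Γ (T.obj c), naturality := fun f => Γ.naturality (T.map f) }

/-- Restriction of pseudocones commutes with the change of vertex. -/
def whiskeringCompRestriction {L : H} (p : PseudoCone A L) (X : H) :
    p.whiskering X ⋙ restriction T A X ≅ (p.restrict T).whiskering X :=
  Iso.refl _

/-- Universal pseudocones can be detected after a restriction that is an equivalence on pseudocones
with every vertex. -/
lemma exists_isUniversal_iff_of_isEquivalence_restriction {L : H}
    (h : ∀ X : H, (restriction T A X).IsEquivalence) :
    (∃ p : PseudoCone (T.comp A) L, p.IsUniversal) ↔ ∃ p : PseudoCone A L, p.IsUniversal := by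
  have key (p : PseudoCone A L) : (p.restrict T).IsUniversal ↔ p.IsUniversal := by
    refine forall_congr' fun X => ?_
    rw [← Functor.isEquivalence_iff_of_iso (p.whiskeringCompRestriction T X)]
    exact ⟨fun _ => Functor.isEquivalence_of_comp_right _ (restriction T A X),
      fun _ => inferInstance⟩
  constructor
  · rintro ⟨q, hq⟩
    obtain ⟨p, ⟨e⟩⟩ := (h L).essSurj.mem_essImage q
    refine ⟨p, (key p).1 fun X => ?_⟩
    exact (Functor.isEquivalence_iff_of_iso (whiskeringIso e X)).2 (hq X)
  · rintro ⟨p, hp⟩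
    exact ⟨p.restrict T, (key p).2 hp⟩

variable {T}

/-- A leg of a pseudocone over `A ∘ T`, as an object of the total category of `A`. -/
def elOver (q : PseudoCone (T.comp A) X) (c : K') : Total A X := ⟨T.obj c, q.leg c⟩

/-- The filler of a triangle of a pseudocone over `A ∘ T`, as a morphism of the total category
of `A`. -/
def trOver (q : PseudoCone (T.comp A) X) {c d : K'} (f : c ⟶ d) : q.elOver c ⟶ q.elOver d :=
  ⟨T.map f, (q.iso f).hom⟩

lemma trOver_id (q : PseudoCone (T.comp A) X) (c : K') : q.trOver (𝟙 c) = 𝟙 _ :=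
  Total.hom_ext (T.mapId c).hom (by
    refine (q.iso_id c).trans ?_
    exact whiskerLeft_comp_assoc (q.leg c) (A.map₂ (T.mapId c).hom) (A.mapId (T.obj c)).hom _)

lemma trOver_comp (q : PseudoCone (T.comp A) X) {c d e : K'} (f : c ⟶ d)
    (g : d ⟶ e) : q.trOver (f ≫ g) = q.trOver f ≫ q.trOver g :=
  Total.hom_ext (T.mapComp f g).hom (by
    refine (q.iso_comp f g).trans ?_
    exact whiskerLeft_comp_assoc (q.leg c) (A.map₂ (T.mapComp f g).hom)
      (A.mapComp (T.map f) (T.map g)).hom _)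

lemma isCocart_trOver (q : PseudoCone (T.comp A) X) {c d : K'} (f : c ⟶ d) :
    Total.IsCocart (q.trOver f) :=
  inferInstanceAs (IsIso (q.iso f).hom)

/-- The vertical morphism given by a `2`-cell between legs of pseudocones over `A ∘ T`. -/
def vertOver {p q : PseudoCone (T.comp A) X} {c : K'} (u : p.leg c ⟶ q.leg c) :
    p.elOver c ⟶ q.elOver c :=
  Total.vert (A := A) u

/-- The version of `naturality_iff_total` for pseudocones over `A ∘ T`, in the total category
of `A`. -/
lemma naturality_iff_trOver {p q : PseudoCone (T.comp A) X} {c d : K'} (f : c ⟶ d)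
    (u : p.leg c ⟶ q.leg c) (u' : p.leg d ⟶ q.leg d) :
    (p.iso f).hom ≫ u' = u ▷ (T.comp A).map f ≫ (q.iso f).hom ↔
      p.trOver f ≫ vertOver u' = vertOver u ≫ q.trOver f := by
  have h₁ : p.trOver f ≫ vertOver u' = ⟨T.map f, (p.iso f).hom ≫ u'⟩ :=
    Total.comp_vert _ _ _
  have h₂ : vertOver u ≫ q.trOver f =
    ⟨T.map f, u ▷ A.map (T.map f) ≫ (q.iso f).hom⟩ := Total.vert_comp _ _ _
  rw [h₁, h₂]
  exact ⟨fun h => congrArg _ h, Total.mk_inj⟩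

end PseudoCone

end Total

/-! ### Generators of `Δ₃` -/

namespace Delta3

open scoped Simplicial

/-- The object `1` of `Δ₃`. -/
abbrev one : Delta3 := ⟨Delta3Quiver.one⟩

/-- The object `2` of `Δ₃`. -/
abbrev two : Delta3 := ⟨Delta3Quiver.two⟩

/-- The object `3` of `Δ₃`. -/
abbrev three : Delta3 := ⟨Delta3Quiver.three⟩

/-- The generators `d⁰, d¹` of `Δ₃`. -/
def d (i : Fin 2) : one ⟶ two :=
  (CategoryTheory.Quotient.functor Delta3Quiver.rel).map (Delta3Quiver.gen (Delta3Quiver.Hom.d i))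

/-- The generator `s⁰` of `Δ₃`. -/
def s : two ⟶ one :=
  (CategoryTheory.Quotient.functor Delta3Quiver.rel).map (Delta3Quiver.gen Delta3Quiver.Hom.s)

/-- The generators `∂⁰, ∂¹, ∂²` of `Δ₃`. -/
def del (k : Fin 3) : two ⟶ three :=
  (CategoryTheory.Quotient.functor Delta3Quiver.rel).map
    (Delta3Quiver.gen (Delta3Quiver.Hom.del k))

lemma d_s (i : Fin 2) : d i ≫ s = 𝟙 one :=
  CategoryTheory.Quotient.sound _ (Delta3Quiver.rel.s_d i)

lemma d_del (i j : Fin 2) (h : i ≤ j) : d i ≫ del j.succ = d j ≫ del i.castSucc :=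
  CategoryTheory.Quotient.sound _ (Delta3Quiver.rel.del_d i j h)

lemma t3_d (i : Fin 2) : t3.map (d i) = SimplexCategory.δ i := by
  exact Category.id_comp _

lemma t3_s : t3.map s = SimplexCategory.σ 0 := Category.id_comp _

lemma t3_del (k : Fin 3) : t3.map (del k) = SimplexCategory.δ k := Category.id_comp _

/-- The morphism `1 ⟶ c` of `Δ₃` whose image in `Δ` is the initial vertex. -/
def initialVertex (c : Delta3) : one ⟶ c :=
  match c with
  | ⟨Delta3Quiver.one⟩ => 𝟙 _
  | ⟨Delta3Quiver.two⟩ => d 1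
  | ⟨Delta3Quiver.three⟩ => d 1 ≫ del 1

lemma t3_initialVertex (c : Delta3) :
    t3.map (initialVertex c) = SimplexCategory.const ⦋0⦌ (t3.obj c) 0 := by
  rcases c with (_ | _ | _)
  · exact SimplexCategory.Hom.ext_zero_left _ _
  · exact (t3_d 1).trans (SimplexCategory.Hom.ext_zero_left _ _)
  · refine (t3.map_comp (d 1) (del 1)).trans ?_
    rw [t3_d, t3_del]
    exact SimplexCategory.Hom.ext_zero_left _ _

lemma initialVertex_s : initialVertex two ≫ s = initialVertex one := d_s 1

lemma initialVertex_del_one : initialVertex two ≫ del 1 = initialVertex three := rfl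

lemma initialVertex_del_two : initialVertex two ≫ del 2 = initialVertex three :=
  d_del 1 1 le_rfl

lemma initialVertex_del_zero : initialVertex two ≫ del 0 = d 0 ≫ del 2 :=
  (d_del 0 1 (Fin.zero_le _)).symm

/-- A multiplicative property of morphisms of `Δ₃` that holds for the generators holds for all
morphisms. -/
lemma morphismProperty_eq_top (P : MorphismProperty Delta3) [P.IsMultiplicative]
    (hd : ∀ i, P (d i)) (hs : P s) (hdel : ∀ k, P (del k)) : P = ⊤ := by
  let G := CategoryTheory.Quotient.functor Delta3Quiver.rel
  have key (x y : Paths Delta3Quiver) (f : x ⟶ y) : P (G.map f) := by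
    refine Paths.induction (fun f => P (G.map f)) ?_ ?_ f
    · intro x
      rw [G.map_id]
      exact P.id_mem _
    · intro x y z p q hp
      rw [G.map_comp]
      refine P.comp_mem _ _ hp ?_
      rcases q with i | _ | k
      exacts [hd i, hs, hdel k]
  ext ⟨x⟩ ⟨y⟩ f
  refine ⟨fun _ => trivial, fun _ => ?_⟩
  obtain ⟨f, rfl⟩ := G.map_surjective f
  exact key _ _ f

end Delta3

/-! ### Vertices, edges and triangles of simplices -/

section Simplices

open scoped Simplicial
open SimplexCategory

/-- The vertex `a` of a simplex. -/
def vertex (n : SimplexCategory) (a : Fin (n.len + 1)) : ⦋0⦌ ⟶ n := SimplexCategory.const ⦋0⦌ n a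

/-- The edge `a ≤ b` of a simplex. -/
def edge (n : SimplexCategory) {a b : Fin (n.len + 1)} (h : a ≤ b) : ⦋1⦌ ⟶ n :=
  SimplexCategory.mkOfLe (n := n.len) a b h

/-- The triangle `a ≤ b ≤ c` of a simplex. -/
def triangle (n : SimplexCategory) {a b c : Fin (n.len + 1)} (h : a ≤ b) (h' : b ≤ c) :
    ⦋2⦌ ⟶ n :=
  SimplexCategory.mkOfLeComp (n := n.len) a b c h h'

variable {n m : SimplexCategory}

lemma δ_zero_edge {a b : Fin (n.len + 1)} (h : a ≤ b) :
    SimplexCategory.δ (0 : Fin 2) ≫ edge n h = vertex n b := Hom.ext_zero_left _ _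

lemma δ_one_edge {a b : Fin (n.len + 1)} (h : a ≤ b) :
    SimplexCategory.δ (1 : Fin 2) ≫ edge n h = vertex n a := Hom.ext_zero_left _ _

lemma δ_zero_triangle {a b c : Fin (n.len + 1)} (h : a ≤ b) (h' : b ≤ c) :
    SimplexCategory.δ (0 : Fin 3) ≫ triangle n h h' = edge n h' := Hom.ext_one_left _ _

lemma δ_one_triangle {a b c : Fin (n.len + 1)} (h : a ≤ b) (h' : b ≤ c) :
    SimplexCategory.δ (1 : Fin 3) ≫ triangle n h h' = edge n (h.trans h') := Hom.ext_one_left _ _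

lemma δ_two_triangle {a b c : Fin (n.len + 1)} (h : a ≤ b) (h' : b ≤ c) :
    SimplexCategory.δ (2 : Fin 3) ≫ triangle n h h' = edge n h := Hom.ext_one_left _ _

lemma vertex_comp (a : Fin (n.len + 1)) (f : n ⟶ m) :
    vertex n a ≫ f = vertex m (f.toOrderHom a) := Hom.ext_zero_left _ _

lemma edge_comp {a b : Fin (n.len + 1)} (h : a ≤ b) (f : n ⟶ m) :
    edge n h ≫ f = edge m (f.toOrderHom.monotone h) := Hom.ext_one_left _ _

lemma edge_refl (a : Fin (n.len + 1)) :
    edge n (le_refl a) = SimplexCategory.σ (0 : Fin 1) ≫ vertex n a := Hom.ext_one_left _ _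

end Simplices

/-! ### Restriction of pseudocones along `t₃` -/

section Restriction

open scoped Simplicial
open SimplexCategory

variable {H : Type u} [Bicategory.{w, v} H] {A : LocallyDiscrete SimplexCategory ⥤ᵖ H} {X : H}

namespace PseudoCone

/-- A family of morphisms between the legs of pseudocones over `A ∘ t₃` is natural for all morphisms
of `Δ₃` if it is so for the generators. -/
lemma trOver_natural_of_generators (q q' : PseudoCone (t3.toPseudofunctor.comp A) X)
    (κ : ∀ c : Delta3, q.elOver ⟨c⟩ ⟶ q'.elOver ⟨c⟩)
    (hd : ∀ i, q.trOver (Delta3.d i).toLoc ≫ κ _ = κ _ ≫ q'.trOver (Delta3.d i).toLoc)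
    (hs : q.trOver Delta3.s.toLoc ≫ κ _ = κ _ ≫ q'.trOver Delta3.s.toLoc)
    (hdel : ∀ i, q.trOver (Delta3.del i).toLoc ≫ κ _ = κ _ ≫ q'.trOver (Delta3.del i).toLoc)
    {c d : Delta3} (f : c ⟶ d) : q.trOver f.toLoc ≫ κ d = κ c ≫ q'.trOver f.toLoc := by
  let P : MorphismProperty Delta3 := fun c d f => q.trOver f.toLoc ≫ κ d = κ c ≫ q'.trOver f.toLoc
  have : P.IsMultiplicative :=
    { id_mem := fun c => by
        change q.trOver (𝟙 _) ≫ κ c = κ c ≫ q'.trOver (𝟙 _)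
        rw [trOver_id, trOver_id, Category.id_comp, Category.comp_id]
      comp_mem := fun {c d e} f g hf hg => by
        change q.trOver f.toLoc ≫ κ d = κ c ≫ q'.trOver f.toLoc at hf
        change q.trOver g.toLoc ≫ κ e = κ d ≫ q'.trOver g.toLoc at hg
        change q.trOver (f.toLoc ≫ g.toLoc) ≫ κ e = κ c ≫ q'.trOver (f.toLoc ≫ g.toLoc)
        rw [trOver_comp, trOver_comp, Category.assoc, hg, ← Category.assoc, hf, Category.assoc] }
  have h := Delta3.morphismProperty_eq_top P hd hs hdel
  have : P f := by rw [h]; trivial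
  exact this

/-- A morphism of pseudocones over `A` is determined by its component at `1`, since the initial
vertex of each simplex gives a cocartesian morphism. -/
instance : (restriction t3.toPseudofunctor A X).Faithful where
  map_injective {p q Γ Θ} h := by
    have h₀ : Hom.app Γ ⟨⦋0⦌⟩ = Hom.app Θ ⟨⦋0⦌⟩ := congrArg (fun Ξ => Hom.app Ξ ⟨Delta3.one⟩) h
    ext ⟨n⟩
    apply Total.vert_injective
    refine (p.isCocart_tr (vertex n 0).toLoc).cancel rfl ?_
    rw [(naturality_iff_total _ _ _).1 (Γ.naturality (vertex n 0).toLoc),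
      (naturality_iff_total _ _ _).1 (Θ.naturality (vertex n 0).toLoc), h₀]

/-- The component at `1` of a morphism over `A ∘ t₃` is extended to each simplex along the initial
vertex. Naturality for the edges, hence for all the vertices, follows from that for `d⁰` and `d¹`,
and implies naturality for all maps of simplices. -/
instance : (restriction t3.toPseudofunctor A X).Full where
  map_surjective {p q} Γ := by
    let g₀ : p.leg ⟨⦋0⦌⟩ ⟶ q.leg ⟨⦋0⦌⟩ := Hom.app Γ ⟨Delta3.one⟩
    let g₁ : p.leg ⟨⦋1⦌⟩ ⟶ q.leg ⟨⦋1⦌⟩ := Hom.app Γ ⟨Delta3.two⟩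
    have hd (i : Fin 2) : p.tr (δ i).toLoc ≫ Total.vert g₁ =
        Total.vert g₀ ≫ q.tr (δ i).toLoc := by
      rw [← Delta3.t3_d]
      exact (naturality_iff_total _ _ _).1 (Γ.naturality (Delta3.d i).toLoc)
    have ex (n : SimplexCategory) : ∃ u : p.leg ⟨n⟩ ⟶ q.leg ⟨n⟩,
        p.tr (vertex n 0).toLoc ≫ Total.vert u =
          Total.vert g₀ ≫ q.tr (vertex n 0).toLoc := by
      obtain ⟨φ, hφ⟩ := (p.isCocart_tr (vertex n 0).toLoc).exists_fac
        (Total.vert g₀ ≫ q.tr (vertex n 0).toLoc) (𝟙 _)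
        (congrArg Quiver.Hom.toLoc ((Category.comp_id _).trans (Category.id_comp _).symm))
      obtain ⟨u, hu⟩ := Total.exists_eq_vert (Total.mkHom (p := p.el ⟨n⟩) (q := q.el ⟨n⟩) _ φ) rfl
      exact ⟨u, hu ▸ hφ⟩
    choose u hu using ex
    have hedge (n : SimplexCategory) (a : Fin (n.len + 1)) :
        p.tr (edge n (Fin.zero_le a)).toLoc ≫ Total.vert (u n) =
          Total.vert g₁ ≫ q.tr (edge n (Fin.zero_le a)).toLoc := by
      refine (p.isCocart_tr (δ (1 : Fin 2)).toLoc).cancel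
        (congrArg Quiver.Hom.toLoc ((Category.comp_id _).trans (Category.id_comp _).symm)) ?_
      rw [← Category.assoc, ← Category.assoc, hd, ← p.tr_comp, Category.assoc, ← q.tr_comp,
        ← Quiver.Hom.comp_toLoc, δ_one_edge, hu]
    have hvert (n : SimplexCategory) (a : Fin (n.len + 1)) :
        p.tr (vertex n a).toLoc ≫ Total.vert (u n) =
          Total.vert g₀ ≫ q.tr (vertex n a).toLoc := by
      rw [← δ_zero_edge (Fin.zero_le a), Quiver.Hom.comp_toLoc, p.tr_comp, q.tr_comp,
        Category.assoc, hedge, ← Category.assoc, hd, Category.assoc]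
    refine ⟨{ app := fun n => u n.as, naturality := fun {n m} f => ?_ }, ?_⟩
    · refine (naturality_iff_total _ _ _).2 ?_
      refine (p.isCocart_tr (vertex n.as 0).toLoc).cancel
        (congrArg Quiver.Hom.toLoc ((Category.comp_id _).trans (Category.id_comp _).symm)) ?_
      have h : (vertex n.as 0).toLoc ≫ f = (vertex m.as (f.as.toOrderHom 0)).toLoc :=
        congrArg Quiver.Hom.toLoc (vertex_comp _ f.as)
      rw [← Category.assoc, ← Category.assoc, hu, ← p.tr_comp, Category.assoc, ← q.tr_comp, h]
      exact hvert _ _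
    · ext ⟨c⟩
      let f := Delta3.initialVertex c
      have hf : t3.map f = vertex (t3.obj c) 0 := Delta3.t3_initialVertex c
      let g : p.leg ⟨t3.obj c⟩ ⟶ q.leg ⟨t3.obj c⟩ := Hom.app Γ ⟨c⟩
      have h : p.tr (t3.map f).toLoc ≫ Total.vert g = Total.vert g₀ ≫ q.tr (t3.map f).toLoc :=
        (naturality_iff_total _ _ _).1 (Γ.naturality f.toLoc)
      have hg : u (t3.obj c) = g := by
        apply Total.vert_injective
        refine (p.isCocart_tr (vertex (t3.obj c) 0).toLoc).cancel rfl ((hu _).trans ?_)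
        rw [hf] at h
        exact h.symm
      exact hg

end PseudoCone

/-- The data of a pseudocone over `A ∘ t₃`, as a diagram of cocartesian morphisms of the total
category of `A` that lies over the diagram `Δ₃` and satisfies its relations. -/
structure DescentDiagram (A : LocallyDiscrete SimplexCategory ⥤ᵖ H) (X : H) where
  /-- The leg at the ordinal `1`. -/
  x₀ : X ⟶ A.obj ⟨⦋0⦌⟩
  /-- The leg at the ordinal `2`. -/
  x₁ : X ⟶ A.obj ⟨⦋1⦌⟩
  /-- The leg at the ordinal `3`. -/
  x₂ : X ⟶ A.obj ⟨⦋2⦌⟩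
  /-- The morphisms over `d⁰` and `d¹`. -/
  D (i : Fin 2) : (⟨_, x₀⟩ : Total A X) ⟶ ⟨_, x₁⟩
  /-- The morphism over `s⁰`. -/
  S : (⟨_, x₁⟩ : Total A X) ⟶ ⟨_, x₀⟩
  /-- The morphisms over `∂⁰`, `∂¹` and `∂²`. -/
  F (i : Fin 3) : (⟨_, x₁⟩ : Total A X) ⟶ ⟨_, x₂⟩
  D_base (i) : (D i).base = (SimplexCategory.δ i).toLoc
  S_base : S.base = (SimplexCategory.σ (0 : Fin 1)).toLoc
  F_base (i) : (F i).base = (SimplexCategory.δ i).toLoc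
  isCocart_D (i) : Total.IsCocart (D i)
  isCocart_S : Total.IsCocart S
  isCocart_F (i) : Total.IsCocart (F i)
  D_S (i) : D i ≫ S = 𝟙 _
  D_F (i j : Fin 2) (h : i ≤ j) : D i ≫ F j.succ = D j ≫ F i.castSucc

namespace DescentDiagram

/-- The descent diagram underlying a pseudocone over `A ∘ t₃`. -/
def ofPseudoCone (q : PseudoCone (t3.toPseudofunctor.comp A) X) : DescentDiagram A X where
  x₀ := q.leg ⟨Delta3.one⟩
  x₁ := q.leg ⟨Delta3.two⟩
  x₂ := q.leg ⟨Delta3.three⟩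
  D i := q.trOver (Delta3.d i).toLoc
  S := q.trOver Delta3.s.toLoc
  F i := q.trOver (Delta3.del i).toLoc
  D_base i := congrArg Quiver.Hom.toLoc (Delta3.t3_d i)
  S_base := congrArg Quiver.Hom.toLoc Delta3.t3_s
  F_base i := congrArg Quiver.Hom.toLoc (Delta3.t3_del i)
  isCocart_D i := q.isCocart_trOver _
  isCocart_S := q.isCocart_trOver _
  isCocart_F i := q.isCocart_trOver _
  D_S i := by
    refine (q.trOver_comp (Delta3.d i).toLoc Delta3.s.toLoc).symm.trans ?_
    rw [← Quiver.Hom.comp_toLoc, Delta3.d_s]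
    exact q.trOver_id _
  D_F i j h := by
    refine (q.trOver_comp (Delta3.d i).toLoc (Delta3.del j.succ).toLoc).symm.trans ?_
    refine Eq.trans ?_ (q.trOver_comp (Delta3.d j).toLoc (Delta3.del i.castSucc).toLoc)
    rw [← Quiver.Hom.comp_toLoc, ← Quiver.Hom.comp_toLoc, Delta3.d_del i j h]

variable (q : DescentDiagram A X)

/-- The extension of a descent diagram to all simplices: the image of `x₀` at the initial
vertex. -/
def leg (n : SimplexCategory) : X ⟶ A.obj ⟨n⟩ := q.x₀ ≫ A.map (vertex n 0).toLoc

/-- The extension of a descent diagram, as an object of the total category. -/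
abbrev el (n : SimplexCategory) : Total A X := ⟨⟨n⟩, q.leg n⟩

/-- The object of the total category over the ordinal `1`. -/
abbrev el₀ : Total A X := ⟨⟨⦋0⦌⟩, q.x₀⟩

/-- The object of the total category over the ordinal `2`. -/
abbrev el₁ : Total A X := ⟨⟨⦋1⦌⟩, q.x₁⟩

/-- The object of the total category over the ordinal `3`. -/
abbrev el₂ : Total A X := ⟨⟨⦋2⦌⟩, q.x₂⟩

/-- The cocartesian morphism over the initial vertex. -/
def initMap (n : SimplexCategory) : q.el₀ ⟶ q.el n := Total.mkHom (vertex n 0).toLoc (𝟙 _)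

lemma isCocart_initMap (n : SimplexCategory) : Total.IsCocart (q.initMap n) :=
  inferInstanceAs (IsIso (𝟙 _))

lemma exists_edgeMap (n : SimplexCategory) (a : Fin (n.len + 1)) :
    ∃ φ : q.x₁ ≫ A.map (edge n (Fin.zero_le a)).toLoc ⟶ q.leg n,
      q.D 1 ≫ Total.mkHom (q := q.el n) (edge n (Fin.zero_le a)).toLoc φ = q.initMap n := by
  refine (q.isCocart_D 1).exists_fac (q.initMap n) (edge n (Fin.zero_le a)).toLoc ?_
  rw [q.D_base, ← Quiver.Hom.comp_toLoc, δ_one_edge]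
  rfl

/-- The extension of `initMap` along the edge from the initial vertex to `a`. -/
noncomputable def edgeMap (n : SimplexCategory) (a : Fin (n.len + 1)) : q.el₁ ⟶ q.el n :=
  Total.mkHom (edge n (Fin.zero_le a)).toLoc (q.exists_edgeMap n a).choose

lemma D_edgeMap (n : SimplexCategory) (a : Fin (n.len + 1)) :
    q.D 1 ≫ q.edgeMap n a = q.initMap n :=
  (q.exists_edgeMap n a).choose_spec

/-- `edgeMap` is characterized by its image in the base and its restriction along `d¹`. -/
lemma eq_edgeMap {n : SimplexCategory} {a : Fin (n.len + 1)} {k : q.el₁ ⟶ q.el n}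
    (hb : k.base = (edge n (Fin.zero_le a)).toLoc) (hk : q.D 1 ≫ k = q.initMap n) :
    k = q.edgeMap n a :=
  (q.isCocart_D 1).cancel hb (hk.trans (q.D_edgeMap n a).symm)

/-- The morphism over the vertex `a`: the image of `d⁰` under the edge from the initial vertex
to `a`. -/
noncomputable def vertexMap (n : SimplexCategory) (a : Fin (n.len + 1)) : q.el₀ ⟶ q.el n :=
  q.D 0 ≫ q.edgeMap n a

lemma vertexMap_base (n : SimplexCategory) (a : Fin (n.len + 1)) :
    (q.vertexMap n a).base = (vertex n a).toLoc := by
  change (q.D 0).base ≫ (edge n (Fin.zero_le a)).toLoc = _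
  rw [q.D_base, ← Quiver.Hom.comp_toLoc, δ_zero_edge]

lemma isCocart_vertexMap (n : SimplexCategory) (a : Fin (n.len + 1)) :
    Total.IsCocart (q.vertexMap n a) :=
  (q.isCocart_D 0).comp ((q.isCocart_D 1).of_comp (by rw [q.D_edgeMap]; exact q.isCocart_initMap n))

/-- This is where the degeneracy is used: the edge from the initial vertex to itself is
degenerate. -/
lemma vertexMap_zero (n : SimplexCategory) : q.vertexMap n 0 = q.initMap n := by
  have h : q.S ≫ q.initMap n = q.edgeMap n 0 := by
    refine q.eq_edgeMap ?_ ?_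
    · change q.S.base ≫ (vertex n 0).toLoc = _
      rw [q.S_base, ← Quiver.Hom.comp_toLoc, ← edge_refl]
    · rw [← Category.assoc, q.D_S, Category.id_comp]
  rw [vertexMap, ← h, ← Category.assoc, q.D_S, Category.id_comp]

lemma exists_φ {n m : SimplexCategory} (f : n ⟶ m) :
    ∃ φ : q.leg n ≫ A.map f.toLoc ⟶ q.leg m,
      q.initMap n ≫ Total.mkHom (p := q.el n) (q := q.el m) f.toLoc φ =
        q.vertexMap m (f.toOrderHom 0) := by
  refine (q.isCocart_initMap n).exists_fac (q.vertexMap m (f.toOrderHom 0)) f.toLoc ?_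
  rw [vertexMap_base, ← vertex_comp]
  rfl

/-- The `2`-cells of the extension of a descent diagram: the one of `f` is determined by sending the
initial vertex of `n` to its image in `m`. -/
noncomputable def φ {n m : SimplexCategory} (f : n ⟶ m) : q.leg n ≫ A.map f.toLoc ⟶ q.leg m :=
  (q.exists_φ f).choose

/-- The morphisms of the extension of a descent diagram. -/
noncomputable def tr {n m : SimplexCategory} (f : n ⟶ m) : q.el n ⟶ q.el m :=
  Total.mkHom f.toLoc (q.φ f)

lemma initMap_tr {n m : SimplexCategory} (f : n ⟶ m) :
    q.initMap n ≫ q.tr f = q.vertexMap m (f.toOrderHom 0) :=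
  (q.exists_φ f).choose_spec

/-- The cocycle condition: the key point is that a triangle of a simplex gives a morphism from
`x₂`, which relates the edges of this triangle. -/
lemma vertexMap_tr {n m : SimplexCategory} (f : n ⟶ m) (a : Fin (n.len + 1)) :
    q.vertexMap n a ≫ q.tr f = q.vertexMap m (f.toOrderHom a) := by
  have hle : f.toOrderHom 0 ≤ f.toOrderHom a := f.toOrderHom.monotone (Fin.zero_le a)
  -- the triangle `0 ≤ f 0 ≤ f a` of `m`
  let t := triangle m (Fin.zero_le (f.toOrderHom 0)) hle
  have hD : Total.IsCocart (q.D 1 ≫ q.F 2) := (q.isCocart_D 1).comp (q.isCocart_F 2)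
  obtain ⟨ψ, hψ⟩ : ∃ ψ : q.x₂ ≫ A.map t.toLoc ⟶ q.leg m,
      (q.D 1 ≫ q.F 2) ≫ Total.mkHom (p := q.el₂) (q := q.el m) t.toLoc ψ = q.initMap m := by
    refine hD.exists_fac (q.initMap m) t.toLoc ?_
    change ((q.D 1).base ≫ (q.F 2).base) ≫ t.toLoc = (vertex m 0).toLoc
    rw [q.D_base, q.F_base, ← Quiver.Hom.comp_toLoc, ← Quiver.Hom.comp_toLoc, Category.assoc,
      δ_two_triangle, δ_one_edge]
  set τ : q.el₂ ⟶ q.el m := Total.mkHom t.toLoc ψ with hτ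
  rw [Category.assoc] at hψ
  have h₂ : q.F 2 ≫ τ = q.edgeMap m (f.toOrderHom 0) := by
    refine q.eq_edgeMap ?_ hψ
    change (q.F 2).base ≫ t.toLoc = _
    rw [q.F_base, ← Quiver.Hom.comp_toLoc, δ_two_triangle]
  have h₁ : q.F 1 ≫ τ = q.edgeMap m (f.toOrderHom a) := by
    refine q.eq_edgeMap ?_ ?_
    · change (q.F 1).base ≫ t.toLoc = _
      rw [q.F_base, ← Quiver.Hom.comp_toLoc, δ_one_triangle]
    · rw [← hψ, ← Category.assoc, ← Category.assoc]
      exact congrArg (· ≫ τ) (q.D_F 1 1 le_rfl).symm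
  have h₀ : q.F 0 ≫ τ = q.edgeMap n a ≫ q.tr f := by
    refine (q.isCocart_D 1).cancel ?_ ?_
    · change (q.F 0).base ≫ t.toLoc = (edge n (Fin.zero_le a)).toLoc ≫ f.toLoc
      rw [q.F_base, ← Quiver.Hom.comp_toLoc, ← Quiver.Hom.comp_toLoc, δ_zero_triangle, edge_comp]
    · rw [← Category.assoc (q.D 1) (q.edgeMap n a), q.D_edgeMap, q.initMap_tr, vertexMap, ← h₂,
        ← Category.assoc, ← Category.assoc]
      exact congrArg (· ≫ τ) (q.D_F 0 1 (Fin.zero_le _)).symm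
  rw [vertexMap, vertexMap, Category.assoc, ← h₀, ← h₁, ← Category.assoc, ← Category.assoc]
  exact congrArg (· ≫ τ) (q.D_F 0 0 le_rfl).symm

/-- The pseudocone over `A` that extends a descent diagram. -/
noncomputable def extension : PseudoCone A X :=
  PseudoCone.ofTotal (fun c => q.leg c.as) (fun f => q.φ f.as)
    (fun {c d} f => by
      refine (q.isCocart_initMap c.as).of_comp (g := q.tr f.as) ?_
      rw [q.initMap_tr]
      exact q.isCocart_vertexMap _ _)
    (fun c => by
      refine (q.isCocart_initMap c.as).cancel (k := q.tr (𝟙 c.as)) rfl ?_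
      rw [q.initMap_tr, Category.comp_id]
      exact q.vertexMap_zero _)
    (fun {c d e} f g => by
      refine (q.isCocart_initMap c.as).cancel (k := q.tr (f.as ≫ g.as))
        (k' := q.tr f.as ≫ q.tr g.as) rfl ?_
      rw [q.initMap_tr, ← Category.assoc, q.initMap_tr, vertexMap_tr]
      rfl)

end DescentDiagram

open DescentDiagram in
/-- A pseudocone `q` over `A ∘ t₃` is isomorphic to the restriction of the extension of its descent
diagram, by the isomorphisms compatible with the initial vertices; their naturality has to be
checked for the generators only. -/
instance : (PseudoCone.restriction t3.toPseudofunctor A X).EssSurj where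
  mem_essImage q := by
    let Q := ofPseudoCone q
    let p := Q.extension.restrict t3.toPseudofunctor
    -- the data of `q`, as morphisms out of its value at `1`
    let V (c : Delta3) (f : Delta3.one ⟶ c) : Q.el₀ ⟶ q.elOver ⟨c⟩ := q.trOver f.toLoc
    have hV {c d : Delta3} (f : Delta3.one ⟶ c) (g : c ⟶ d) :
      V c f ≫ q.trOver g.toLoc = V d (f ≫ g) := (q.trOver_comp f.toLoc g.toLoc).symm
    have hV' (c : Delta3) : Total.IsCocart (V c (Delta3.initialVertex c)) := q.isCocart_trOver _
    have hbase (c : Delta3) : (V c (Delta3.initialVertex c)).base = (vertex (t3.obj c) 0).toLoc :=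
      congrArg Quiver.Hom.toLoc (Delta3.t3_initialVertex c)
    -- the data of `Q.extension`, seen over `Δ₃`
    let i (c : Delta3) : Q.el₀ ⟶ p.elOver ⟨c⟩ := Q.initMap (t3.obj c)
    have hi (c : Delta3) : Total.IsCocart (i c) := Q.isCocart_initMap _
    let x (c : Delta3) (a : Fin ((t3.obj c).len + 1)) : Q.el₀ ⟶ p.elOver ⟨c⟩ :=
      Q.vertexMap (t3.obj c) a
    have hx₀ (c : Delta3) : x c 0 = i c := Q.vertexMap_zero _
    have hitr {c d : Delta3} (f : c ⟶ d) :
      i c ≫ p.trOver f.toLoc = x d ((t3.map f).toOrderHom 0) := Q.initMap_tr (t3.map f)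
    let e (c : Delta3) (a : Fin ((t3.obj c).len + 1)) : Q.el₁ ⟶ p.elOver ⟨c⟩ :=
      Q.edgeMap (t3.obj c) a
    have he (c : Delta3) (a : Fin ((t3.obj c).len + 1)) : Q.D 1 ≫ e c a = i c :=
      Q.D_edgeMap _ _
    have hxe (c : Delta3) (a : Fin ((t3.obj c).len + 1)) : x c a = Q.D 0 ≫ e c a := rfl
    -- the comparison of `Q.extension` with `q`
    have ex (c : Delta3) : ∃ u : p.leg ⟨c⟩ ⟶ q.leg ⟨c⟩,
        i c ≫ PseudoCone.vertOver u = V c (Delta3.initialVertex c) := by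
      obtain ⟨φ, hφ⟩ := (hi c).exists_fac (V c (Delta3.initialVertex c)) (𝟙 _) (by
        rw [hbase]
        exact congrArg Quiver.Hom.toLoc (Category.comp_id (vertex (t3.obj c) 0)))
      obtain ⟨u, hu⟩ := Total.exists_eq_vert
        (Total.mkHom (p := p.elOver ⟨c⟩) (q := q.elOver ⟨c⟩) _ φ) rfl
      exact ⟨u, (congrArg (i c ≫ ·) hu.symm).trans hφ⟩
    choose u hu using ex
    have hiso (c : Delta3) : IsIso (u c) := Total.isIso_of_isCocart_vert (A := A)
      ((hi c).of_comp (g := PseudoCone.vertOver (u c)) (by rw [hu]; exact hV' c))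
    have key {c d : Delta3} (f : c ⟶ d)
        (h : x d ((t3.map f).toOrderHom 0) ≫ PseudoCone.vertOver (u d) =
          V d (Delta3.initialVertex c ≫ f)) :
        p.trOver f.toLoc ≫ PseudoCone.vertOver (u d) =
          PseudoCone.vertOver (u c) ≫ q.trOver f.toLoc := by
      refine (hi c).cancel
        (congrArg Quiver.Hom.toLoc ((Category.comp_id _).trans (Category.id_comp _).symm)) ?_
      rw [← Category.assoc, ← Category.assoc, hitr, hu, h, hV]
    -- naturality for the generators that preserve the initial vertex
    have key₀ {c d : Delta3} (f : c ⟶ d) (h₀ : (t3.map f).toOrderHom 0 = 0)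
        (hf : Delta3.initialVertex c ≫ f = Delta3.initialVertex d) :
        p.trOver f.toLoc ≫ PseudoCone.vertOver (u d) =
          PseudoCone.vertOver (u c) ≫ q.trOver f.toLoc :=
      key f (by rw [h₀, hx₀, hu, hf])
    let V₁ (c : Delta3) (f : Delta3.two ⟶ c) : Q.el₁ ⟶ q.elOver ⟨c⟩ := q.trOver f.toLoc
    have hV₁ (k : Fin 2) {c : Delta3} (f : Delta3.two ⟶ c) :
      Q.D k ≫ V₁ c f = V c (Delta3.d k ≫ f) := hV (Delta3.d k) f
    -- naturality for the generators that move the initial vertex along an edge `g` of `Δ₃`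
    have key₁ {c d : Delta3} (f : c ⟶ d) (g : Delta3.two ⟶ d)
        (hg : t3.map g = edge (t3.obj d) (Fin.zero_le ((t3.map f).toOrderHom 0)))
        (hg₁ : Delta3.d 1 ≫ g = Delta3.initialVertex d)
        (hg₀ : Delta3.d 0 ≫ g = Delta3.initialVertex c ≫ f) :
        p.trOver f.toLoc ≫ PseudoCone.vertOver (u d) =
          PseudoCone.vertOver (u c) ≫ q.trOver f.toLoc := by
      refine key f ?_
      have h : e d ((t3.map f).toOrderHom 0) ≫ PseudoCone.vertOver (u d) = V₁ d g := by
        refine (Q.isCocart_D 1).cancel ?_ ?_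
        · exact congrArg Quiver.Hom.toLoc ((Category.comp_id _).trans hg.symm)
        · rw [← Category.assoc, he, hu, hV₁, hg₁]
      rw [hxe, Category.assoc, h, hV₁, hg₀]
    refine ⟨Q.extension, ⟨PseudoCone.isoMk (fun c => @asIso _ _ _ _ (u c.as) (hiso c.as))
      (fun f => (PseudoCone.naturality_iff_trOver _ _ _).2 ?_)⟩⟩
    refine PseudoCone.trOver_natural_of_generators p q
      (fun c => PseudoCone.vertOver (u c)) (fun k => ?_) ?_ (fun k => ?_) f.as
    · fin_cases k
      · exact key₁ _ (𝟙 _) (Hom.ext_one_left _ _) (Category.comp_id _)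
          ((Category.comp_id _).trans (Category.id_comp _).symm)
      · exact key₀ _ rfl (Category.id_comp _)
    · exact key₀ _ rfl Delta3.initialVertex_s
    · fin_cases k
      · exact key₁ _ (Delta3.del 2) (Hom.ext_one_left _ _) Delta3.initialVertex_del_two
          Delta3.initialVertex_del_zero.symm
      · exact key₀ _ rfl Delta3.initialVertex_del_one
      · exact key₀ _ rfl Delta3.initialVertex_del_two

variable (A X) in
lemma isEquivalence_restriction_t3 :
    (PseudoCone.restriction t3.toPseudofunctor A X).IsEquivalence where

/-- Descent objects are the vertices of universal pseudocones. -/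
lemma isDescentObject_iff (A : LocallyDiscrete SimplexCategory ⥤ᵖ H) (D : H) :
    IsDescentObject A D ↔ ∃ p : PseudoCone A D, p.IsUniversal :=
  (isWeightedBilimit_iff_of_isContractible isContractible_descentWeight _ D).trans
    (PseudoCone.exists_isUniversal_iff_of_isEquivalence_restriction t3.toPseudofunctor
      (isEquivalence_restriction_t3 A))

lemma isConicalBilimit_iff {C : Type} [Category.{0} C] (A : LocallyDiscrete C ⥤ᵖ H) (D : H) :
    IsConicalBilimit A D ↔ ∃ p : PseudoCone A D, p.IsUniversal :=
  isWeightedBilimit_iff_of_isContractible (isContractible_terminalWeight C) A D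

end Restriction

/-! ### Bilimits weighted by representables -/

section Yoneda

universe w₁ v₁ u₁

variable {K : Type u₁} [Bicategory.{w₁, v₁} K] {H : Type u} [Bicategory.{w, v} H]

/-- A corepresentation of a weight on a locally discrete bicategory by an object `m`, in unpacked
form: every value `W c` is equivalent to the discrete category of morphisms `m ⟶ c`. -/
structure Corepresentation (W : K ⥤ᵖ Cat.{w, v}) (m : K) where
  /-- The universal element. -/
  pt : W.obj m
  /-- The morphism corresponding to an element. -/
  arrow {c : K} (x : W.obj c) : m ⟶ c
  /-- Every element is the image of the universal element under the corresponding morphism. -/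
  iso {c : K} (x : W.obj c) : (W.map (arrow x)).toFunctor.obj pt ≅ x
  arrow_map {c d : K} (f : c ⟶ d) (x : W.obj c) :
    arrow ((W.map f).toFunctor.obj x) = arrow x ≫ f
  arrow_eq {c : K} {x y : W.obj c} (u : x ⟶ y) : arrow x = arrow y
  arrow_pt : arrow pt = 𝟙 m
  hom_eq {c : K} {x y : W.obj c} (u u' : x ⟶ y) : u = u'

/-- The naturality of `compNat` with respect to `2`-cells of the source. -/
lemma compNat_congr {A : K ⥤ᵖ H} {X : H} {W : K ⥤ᵖ Cat.{w, v}} (α : W ⟶ A.comp (homFrom X))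
    {c d : K} {f g : c ⟶ d} (η : f ⟶ g) (x : W.obj c) :
    (compFunctor α d).map ((W.map₂ η).toNatTrans.app x) ≫ (compNat α g x).hom =
      (compNat α f x).hom ≫ (compFunctor α c).obj x ◁ A.map₂ η :=
  congr_natTrans_app (α.naturality_naturality η) x

namespace Corepresentation

variable {A : K ⥤ᵖ H} {X : H} {W : K ⥤ᵖ Cat.{w, v}} {m : K} (R : Corepresentation W m)

/-- Modifications are determined by their component at the universal element. -/
lemma mod_ext {α β : W ⟶ A.comp (homFrom X)} {Γ Θ : α ⟶ β}
    (h : (modApp Γ m).app R.pt = (modApp Θ m).app R.pt) : Γ = Θ := by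
  refine PseudoKan.mod_ext fun c x => ?_
  have h₁ : (modApp Γ c).app ((W.map (R.arrow x)).toFunctor.obj R.pt) =
      (modApp Θ c).app ((W.map (R.arrow x)).toFunctor.obj R.pt) := by
    rw [← cancel_mono (compNat β (R.arrow x) R.pt).hom, modApp_natural, modApp_natural, h]
  rw [← cancel_epi ((compFunctor α c).map (R.iso x).hom), NatTrans.naturality,
    NatTrans.naturality, h₁]

variable (A)

/-- The image of the arrow of the universal element is isomorphic to the identity. -/
def mapPtIso : A.map (R.arrow R.pt) ≅ 𝟙 (A.obj m) :=
  A.map₂Iso (eqToIso R.arrow_pt) ≪≫ A.mapId m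

/-- Evaluation at the universal element of the transformation corresponding to `k`. -/
def evalIso (k : X ⟶ A.obj m) : k ≫ A.map (R.arrow R.pt) ≅ k :=
  whiskerLeftIso k (R.mapPtIso A) ≪≫ ρ_ k

lemma evalIso_natural {k k' : X ⟶ A.obj m} (η : k ⟶ k') :
    η ▷ A.map (R.arrow R.pt) ≫ (R.evalIso A k').hom = (R.evalIso A k).hom ≫ η := by
  simp [evalIso, ← whisker_exchange_assoc]

variable [IsLocallyDiscrete K]

lemma map₂_eq {c d : K} {f g : c ⟶ d} (η θ : f ⟶ g) : A.map₂ η = A.map₂ θ :=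
  congrArg _ (Subsingleton.elim _ _)

/-- The universal transformation `W ⟶ H(A m, A -)`, sending an element `x` to `A.map x`. -/
def trans : W ⟶ A.comp (homFrom (A.obj m)) :=
  strongTransMk
    (fun c => ⟨{ obj := fun x => A.map (R.arrow x)
                 map := fun u => A.map₂ (eqToHom (R.arrow_eq u))
                 map_id := fun _ => A.map₂_id _
                 map_comp := fun _ _ => (map₂_eq A _ _).trans (A.map₂_comp _ _) }⟩)
    (fun {c d} f => catIso (NatIso.ofComponents
      (fun x => A.map₂Iso (eqToIso (R.arrow_map f x)) ≪≫ A.mapComp _ _)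
      (fun {x y} u => by
        have h : A.map₂ (eqToHom (R.arrow_eq ((W.map f).toFunctor.map u))) ≫
            A.map₂ (eqToHom (R.arrow_map f y)) ≫ (A.mapComp (R.arrow y) f).hom =
            (A.map₂ (eqToHom (R.arrow_map f x)) ≫ (A.mapComp (R.arrow x) f).hom) ≫
              A.map₂ (eqToHom (R.arrow_eq u)) ▷ A.map f := by
          have h' := A.map₂_whisker_right (eqToHom (R.arrow_eq u)) f
          rw [← Category.assoc, Iso.eq_comp_inv] at h'
          rw [Category.assoc, ← h', ← Category.assoc, ← Category.assoc, ← A.map₂_comp,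
            ← A.map₂_comp]
          exact congrArg (· ≫ _) (map₂_eq A _ _)
        exact h)))
    (fun c => cat_hom₂_ext fun x => by
      have h : (A.map₂ (eqToHom (R.arrow_map (𝟙 c) x)) ≫ (A.mapComp (R.arrow x) (𝟙 c)).hom) ≫
          A.map (R.arrow x) ◁ (A.mapId c).hom ≫ (ρ_ _).hom =
          A.map₂ (eqToHom (R.arrow_eq ((W.mapId c).hom.toNatTrans.app x))) := by
        rw [Category.assoc, ← A.map₂_right_unitor, ← A.map₂_comp]
        exact map₂_eq A _ _
      exact h.trans ((Category.comp_id _).symm.trans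
        (congrArg (_ ≫ ·) (Category.comp_id _).symm)))
    (fun {c d e} f g => cat_hom₂_ext fun x => by
      have h : (A.map₂ (eqToHom (R.arrow_map (f ≫ g) x)) ≫
            (A.mapComp (R.arrow x) (f ≫ g)).hom) ≫
          A.map (R.arrow x) ◁ (A.mapComp f g).hom ≫ (α_ _ _ _).inv =
          A.map₂ (eqToHom (R.arrow_eq ((W.mapComp f g).hom.toNatTrans.app x))) ≫ 𝟙 _ ≫
          (A.map₂ (eqToHom (R.arrow_map g ((W.map f).toFunctor.obj x))) ≫
            (A.mapComp (R.arrow ((W.map f).toFunctor.obj x)) g).hom) ≫ 𝟙 _ ≫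
          (A.map₂ (eqToHom (R.arrow_map f x)) ≫ (A.mapComp (R.arrow x) f).hom) ▷ A.map g ≫
            𝟙 _ := by
        have h' := A.map₂_whisker_right (eqToHom (R.arrow_map f x)) g
        rw [← Category.assoc, Iso.eq_comp_inv] at h'
        simp only [Category.id_comp, Category.comp_id, Category.assoc, comp_whiskerRight]
        rw [← Category.assoc (A.mapComp (R.arrow ((W.map f).toFunctor.obj x)) g).hom, ← h',
          Category.assoc, A.mapComp_assoc_left_hom]
        simp only [← Category.assoc, ← A.map₂_comp]
        exact congrArg (fun z => ((z ≫ _) ≫ _) ≫ _) (map₂_eq A _ _)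
      exact h)

lemma compNat_comparison (k : X ⟶ A.obj m) {c d : K} (f : c ⟶ d) (x : W.obj c) :
    (compNat ((bilimitComparison W A (A.obj m) (R.trans A) X).obj k) f x).hom =
      k ◁ (A.map₂ (eqToHom (R.arrow_map f x)) ≫ (A.mapComp (R.arrow x) f).hom) ≫
        (α_ k (A.map (R.arrow x)) (A.map f)).inv := by
  have h : 𝟙 _ ≫ k ◁ (A.map₂ (eqToHom (R.arrow_map f x)) ≫ (A.mapComp (R.arrow x) f).hom) ≫ 𝟙 _ ≫
        (α_ k (A.map (R.arrow x)) (A.map f)).inv ≫ 𝟙 _ =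
      k ◁ (A.map₂ (eqToHom (R.arrow_map f x)) ≫ (A.mapComp (R.arrow x) f).hom) ≫
        (α_ k (A.map (R.arrow x)) (A.map f)).inv := by simp
  exact h

/-- A transformation on a corepresented weight is determined by the image of the universal
element. -/
def comparisonIso (α : W ⟶ A.comp (homFrom X)) :
    (bilimitComparison W A (A.obj m) (R.trans A) X).obj ((compFunctor α m).obj R.pt) ≅ α :=
  modIsoMk (fun c => NatIso.ofComponents
      (fun x => (compNat α (R.arrow x) R.pt).symm ≪≫ (compFunctor α c).mapIso (R.iso x))
      (fun {x y} u => by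
        have h : (compFunctor α m).obj R.pt ◁ A.map₂ (eqToHom (R.arrow_eq u)) ≫
            (compNat α (R.arrow y) R.pt).inv ≫ (compFunctor α c).map (R.iso y).hom =
            ((compNat α (R.arrow x) R.pt).inv ≫ (compFunctor α c).map (R.iso x).hom) ≫
              (compFunctor α c).map u := by
          rw [Category.assoc, Iso.eq_inv_comp, ← Category.assoc, ← compNat_congr, Category.assoc,
            Iso.hom_inv_id_assoc, ← Functor.map_comp, ← Functor.map_comp]
          exact congrArg _ (R.hom_eq _ _)
        exact h))
    (fun {c d} f x => by
      rw [compNat_comparison]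
      let k := (compFunctor α m).obj R.pt
      have h : ((compNat α (R.arrow ((W.map f).toFunctor.obj x)) R.pt).inv ≫
          (compFunctor α d).map (R.iso ((W.map f).toFunctor.obj x)).hom) ≫ (compNat α f x).hom =
          (k ◁ (A.map₂ (eqToHom (R.arrow_map f x)) ≫ (A.mapComp (R.arrow x) f).hom) ≫
            (α_ k (A.map (R.arrow x)) (A.map f)).inv) ≫
          ((compNat α (R.arrow x) R.pt).inv ≫ (compFunctor α c).map (R.iso x).hom) ▷ A.map f := by
        have h₁ := compNat_comp α (R.arrow x) f R.pt _ rfl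
        have h₂ := compNat_natural α f (R.iso x).hom
        have h₃ := compNat_congr α (eqToHom (R.arrow_map f x)) R.pt
        rw [Category.assoc, Iso.inv_comp_eq, whiskerLeft_comp, Category.assoc, Category.assoc,
          ← Category.assoc (compNat α _ R.pt).hom, ← h₃, Category.assoc,
          ← Category.assoc (_ ◁ (A.mapComp _ _).hom), ← Category.assoc (compNat α _ R.pt).hom, h₁,
          comp_whiskerRight]
        simp only [Category.assoc]
        rw [hom_inv_whiskerRight_assoc, ← h₂, ← Category.assoc, ← Category.assoc,
          ← Functor.map_comp, ← Functor.map_comp]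
        exact congrArg (fun z => (compFunctor α d).map z ≫ _) (R.hom_eq _ _)
      exact h)

lemma isEquivalence_comparison :
    (bilimitComparison W A (A.obj m) (R.trans A) X).IsEquivalence where
  faithful := ⟨fun {k k' η θ} h => by
    have h' : η ▷ A.map (R.arrow R.pt) = θ ▷ A.map (R.arrow R.pt) :=
      congrArg (fun Γ => (modApp Γ m).app R.pt) h
    rw [← cancel_epi (R.evalIso A k).hom, ← evalIso_natural, ← evalIso_natural, h']⟩
  full := ⟨fun {k k'} Γ => by
    let g : k ≫ A.map (R.arrow R.pt) ⟶ k' ≫ A.map (R.arrow R.pt) := (modApp Γ m).app R.pt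
    refine ⟨(R.evalIso A k).inv ≫ g ≫ (R.evalIso A k').hom, R.mod_ext ?_⟩
    have h : ((R.evalIso A k).inv ≫ g ≫ (R.evalIso A k').hom) ▷ A.map (R.arrow R.pt) = g := by
      rw [← cancel_mono (R.evalIso A k').hom, evalIso_natural, Iso.hom_inv_id_assoc]
    exact h⟩
  essSurj := ⟨fun α => ⟨_, ⟨R.comparisonIso A α⟩⟩⟩

lemma isWeightedBilimit (R : Corepresentation W m) : IsWeightedBilimit W A (A.obj m) :=
  ⟨R.trans A, fun _ => R.isEquivalence_comparison A⟩

end Corepresentation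

end Yoneda

/-- A weight represented by an object in the image of a fully faithful functor is corepresented. -/
noncomputable def corepresentationRepresentableWeight {C : Type u} [Category C] {K : Type u}
    [Category.{0} K] (j : C ⥤ K) [j.Full] [j.Faithful] (m : C) :
    Corepresentation (representableWeight.{w, v} j (j.obj m)) ⟨m⟩ where
  pt := (⟨⟨𝟙 (j.obj m)⟩⟩ : ULift (Discrete (j.obj m ⟶ j.obj m)))
  arrow {c} x := (j.preimage ((ULift.down x : Discrete (j.obj m ⟶ j.obj c.as)).as)).toLoc
  iso {c} x := eqToIso (ULift.ext (α := Discrete (j.obj m ⟶ j.obj c.as)) _ _ (Discrete.ext (by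
    change 𝟙 _ ≫ j.map (j.preimage _) = _
    rw [j.map_preimage, Category.id_comp])))
  arrow_map {c d} f x := congrArg Quiver.Hom.toLoc (j.map_injective (by
    change j.map (j.preimage (_ ≫ j.map f.as)) = j.map (_ ≫ _)
    exact (j.map_preimage _).trans ((congrArg (· ≫ j.map f.as) (j.map_preimage _).symm).trans
      (j.map_comp _ _).symm)))
  arrow_eq u := congrArg (fun z => (j.preimage z).toLoc) (Discrete.eq_of_hom (ULift.down u))
  arrow_pt := congrArg Quiver.Hom.toLoc (j.preimage_id)
  hom_eq {c x y} u u' := ULift.ext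
    (α := (ULift.down x : Discrete (j.obj m ⟶ j.obj c.as)) ⟶ ULift.down y) u u'
    (Subsingleton.elim _ _)

instance : j.Full := inferInstanceAs (WithInitial.incl : SimplexCategory ⥤ _).Full

instance : j.Faithful := inferInstanceAs (WithInitial.incl : SimplexCategory ⥤ _).Faithful

/-- The bilimits weighted by representables all exist if and only if a descent object does. -/
lemma exists_isWeightedBilimit_iff {H : Type u} [Bicategory.{w, v} H]
    (A : LocallyDiscrete SimplexCategory ⥤ᵖ H) : (∃ D : H, IsDescentObject A D) ↔
      ∀ n : AugmentedSimplexCategory, ∃ L : H, IsWeightedBilimit (representableWeight j n) A L := by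
  -- the weight represented by the ordinal `0` is contractible since this ordinal is initial
  have h₀ (D : H) : IsDescentObject A D ↔
      IsWeightedBilimit (representableWeight j zeroOrdinal) A D :=
    (isDescentObject_iff A D).trans (isWeightedBilimit_iff_of_isContractible
      isContractible_representableWeight_zeroOrdinal A D).symm
  constructor
  · rintro ⟨D, hD⟩ (n | _)
    · exact ⟨A.obj ⟨n⟩, (corepresentationRepresentableWeight j n).isWeightedBilimit A⟩
    · exact ⟨D, (h₀ D).1 hD⟩
  · intro h
    obtain ⟨D, hD⟩ := h zeroOrdinal
    exact ⟨D, (h₀ D).2 hD⟩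

/-! ### Pseudocones and pseudonatural transformations -/

section PostcompCone

universe w₁ v₁ u₁

variable {K : Type u₁} [Bicategory.{w₁, v₁} K] {H : Type u} [Bicategory.{w, v} H]

namespace PseudoCone

variable {A B : K ⥤ᵖ H} {X : H}

/-- The pseudocone over `B` obtained from a pseudocone over `A` and a pseudonatural transformation
`A ⟶ B`. -/
@[simps]
def postcomp (p : PseudoCone A X) (β : A ⟶ B) : PseudoCone B X where
  leg c := p.leg c ≫ β.app c
  iso {c d} f := α_ _ _ _ ≪≫ whiskerLeftIso (p.leg c) (β.naturality f).symm ≪≫ (α_ _ _ _).symm ≪≫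
    whiskerRightIso (p.iso f) (β.app d)
  iso_id c := by
    have h : (β.naturality (𝟙 c)).inv ≫ (A.mapId c).hom ▷ β.app c =
        β.app c ◁ (B.mapId c).hom ≫ (ρ_ _).hom ≫ (λ_ _).inv := by
      rw [Iso.inv_comp_eq, ← Category.assoc, β.naturality_id]
      simp
    simp only [Iso.trans_hom, whiskerLeftIso_hom, Iso.symm_hom, whiskerRightIso_hom, p.iso_id,
      comp_whiskerRight, whisker_assoc, Category.assoc, Iso.inv_hom_id_assoc]
    rw [← whiskerLeft_comp_assoc, h]
    simp
  iso_comp {c d e} f g := by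
    have h : (β.naturality (f ≫ g)).inv ≫ (A.mapComp f g).hom ▷ β.app e =
        β.app c ◁ (B.mapComp f g).hom ≫ (α_ _ _ _).inv ≫ (β.naturality f).inv ▷ B.map g ≫
          (α_ _ _ _).hom ≫ A.map f ◁ (β.naturality g).inv ≫ (α_ _ _ _).inv := by
      rw [Iso.inv_comp_eq, ← Category.assoc, β.naturality_comp]
      simp
    simp only [Iso.trans_hom, whiskerLeftIso_hom, Iso.symm_hom, whiskerRightIso_hom, p.iso_comp,
      comp_whiskerRight, whisker_assoc, Category.assoc, Iso.inv_hom_id_assoc]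
    rw [← whiskerLeft_comp_assoc, h]
    have h' := whisker_exchange (p.iso f).hom (β.naturality g).inv
    have h'' : (p.iso f).hom ▷ β.app d ▷ B.map g ≫ (α_ _ _ _).hom ≫
        p.leg d ◁ (β.naturality g).inv = (α_ _ _ _).hom ≫ (_ ◁ (β.naturality g).inv) ≫
          (p.iso f).hom ▷ (A.map g ≫ β.app e) := by
      rw [h']
      simp
    simp only [whiskerLeft_comp, Category.assoc]
    rw [reassoc_of% h'']
    simp

/-- The functoriality of `postcomp` in the pseudonatural transformation. -/
def postcompMap (p : PseudoCone A X) {β β' : A ⟶ B} (Θ : β ⟶ β') :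
    p.postcomp β ⟶ p.postcomp β' where
  app c := p.leg c ◁ Θ.as.app c
  naturality {c d} f := by
    have h : (β.naturality f).inv ≫ A.map f ◁ Θ.as.app d =
        Θ.as.app c ▷ B.map f ≫ (β'.naturality f).inv := by
      rw [Iso.inv_comp_eq, ← Category.assoc, Iso.eq_comp_inv, Θ.as.naturality]
    have h' := whisker_exchange (p.iso f).hom (Θ.as.app d)
    have key : ((α_ _ _ _).hom ≫ p.leg c ◁ (β.naturality f).inv ≫ (α_ _ _ _).inv ≫
        (p.iso f).hom ▷ β.app d) ≫ p.leg d ◁ Θ.as.app d =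
        (p.leg c ◁ Θ.as.app c) ▷ B.map f ≫ (α_ _ _ _).hom ≫ p.leg c ◁ (β'.naturality f).inv ≫
          (α_ _ _ _).inv ≫ (p.iso f).hom ▷ β'.app d := by
      simp only [Category.assoc, ← h', comp_whiskerLeft, Iso.inv_hom_id_assoc, whisker_assoc]
      rw [← whiskerLeft_comp_assoc, h, ← whiskerLeft_comp_assoc]
    exact key

end PseudoCone

end PostcompCone

/-! ### Coherence over locally discrete bicategories -/

section MapComp

variable {L : Type*} [Bicategory L] [IsLocallyDiscrete L] {H : Type u} [Bicategory.{w, v} H]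

/-- The isomorphism `S h ≅ S f ≫ S g` for a pseudofunctor `S` on a locally discrete bicategory and
morphisms such that `h = f ≫ g`. -/
def mapCompIso (S : L ⥤ᵖ H) {a b c : L} {f : a ⟶ b} {g : b ⟶ c} {h : a ⟶ c} (e : h = f ≫ g) :
    S.map h ≅ S.map f ≫ S.map g :=
  S.map₂Iso (eqToIso e) ≪≫ S.mapComp f g

lemma mapCompIso_id (S : L ⥤ᵖ H) {a b : L} {f : a ⟶ b} {k : b ⟶ b} (p : k ⟶ 𝟙 b)
    (e : f = f ≫ k) :
    (mapCompIso S e).symm.hom = S.map f ◁ (S.map₂ p ≫ (S.mapId b).hom) ≫ (ρ_ (S.map f)).hom := by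
  obtain rfl := obj_ext_of_isDiscrete p
  obtain rfl : p = 𝟙 _ := Subsingleton.elim _ _
  rw [Iso.symm_hom, ← cancel_epi (mapCompIso S e).hom, Iso.hom_inv_id]
  simp only [mapCompIso, Iso.trans_hom, PrelaxFunctor.map₂Iso_hom, PrelaxFunctor.map₂_id,
    Category.id_comp, Category.assoc]
  rw [← S.map₂_right_unitor, ← S.map₂_comp, ← S.map₂_id]
  exact congrArg _ (Subsingleton.elim _ _)

lemma mapCompIso_comp (S : L ⥤ᵖ H) {a b c d : L} {fb : a ⟶ b} {fc : a ⟶ c} {fd : a ⟶ d}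
    {g : b ⟶ c} {h : c ⟶ d} {k : b ⟶ d} (p : k ⟶ g ≫ h) (e : fd = fb ≫ k) (e₁ : fc = fb ≫ g)
    (e₂ : fd = fc ≫ h) :
    (mapCompIso S e).symm.hom = S.map fb ◁ (S.map₂ p ≫ (S.mapComp g h).hom) ≫
      (α_ (S.map fb) (S.map g) (S.map h)).inv ≫ (mapCompIso S e₁).symm.hom ▷ S.map h ≫
        (mapCompIso S e₂).symm.hom := by
  obtain rfl := obj_ext_of_isDiscrete p
  obtain rfl : p = 𝟙 _ := Subsingleton.elim _ _
  subst e₁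
  have h₁ : (mapCompIso S (rfl : fb ≫ g = fb ≫ g)) = S.mapComp fb g := by
    refine Iso.ext ?_
    change S.map₂ (𝟙 _) ≫ _ = _
    rw [S.map₂_id, Category.id_comp]
  rw [h₁, Iso.symm_hom, Iso.symm_hom, Iso.symm_hom, ← cancel_epi (mapCompIso S e).hom,
    Iso.hom_inv_id, ← cancel_mono (mapCompIso S e₂).hom]
  have h₂ := S.mapComp_assoc_right_hom fb g h
  simp only [mapCompIso, Iso.trans_hom, PrelaxFunctor.map₂Iso_hom, PrelaxFunctor.map₂_id,
    Category.id_comp, Category.assoc]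
  have h₃ : (S.map₂Iso (eqToIso e₂) ≪≫ S.mapComp (fb ≫ g) h).inv ≫ S.map₂ (eqToIso e₂).hom ≫
      (S.mapComp (fb ≫ g) h).hom = 𝟙 _ := Iso.inv_hom_id _
  rw [reassoc_of% h₂, Iso.hom_inv_id_assoc, hom_inv_whiskerRight_assoc, h₃, Category.comp_id,
    ← Category.assoc, ← S.map₂_comp]
  exact congrArg (· ≫ _) (congrArg _ (Subsingleton.elim _ _))

/-- The compatibility of naturality isomorphisms with composition, in terms of their inverses. -/
lemma naturality_comp_iff_inv {a b c a' b' c' : H} (k : a ⟶ a') {p : a' ⟶ b'} {q : b' ⟶ c'}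
    {r : a' ⟶ c'} (m : r ≅ p ≫ q) {s : a ⟶ b} {t : b ⟶ c} {l : a ⟶ c} (m' : l ≅ s ≫ t)
    {x : b ⟶ b'} {y : c ⟶ c'} (n : t ≫ y ≅ x ≫ q) (n' : l ≫ y ≅ k ≫ r) (n'' : s ≫ x ≅ k ≫ p) :
    n'.hom ≫ k ◁ m.hom = m'.hom ▷ y ≫ (α_ _ _ _).hom ≫ s ◁ n.hom ≫ (α_ _ _ _).inv ≫
        n''.hom ▷ q ≫ (α_ _ _ _).hom ↔
      ((α_ _ _ _).hom ≫ k ◁ m.inv) ≫ n'.inv =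
        n''.inv ▷ q ≫ (α_ _ _ _).hom ≫ s ◁ n.inv ≫ (α_ _ _ _).inv ≫ m'.inv ▷ y := by
  have h₁ : n'.hom ≫ k ◁ m.hom = (n' ≪≫ whiskerLeftIso k m).hom := rfl
  have h₂ : m'.hom ▷ y ≫ (α_ _ _ _).hom ≫ s ◁ n.hom ≫ (α_ _ _ _).inv ≫
      n''.hom ▷ q ≫ (α_ _ _ _).hom = (whiskerRightIso m' y ≪≫ α_ _ _ _ ≪≫ whiskerLeftIso s n ≪≫
        (α_ _ _ _).symm ≪≫ whiskerRightIso n'' q ≪≫ α_ _ _ _).hom := rfl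
  rw [h₁, h₂, ← Iso.inv_eq_inv]
  simp only [Iso.trans_inv, whiskerLeftIso_inv, whiskerRightIso_inv, Iso.symm_inv, Category.assoc]
  rw [Iso.eq_inv_comp]

lemma naturality_mapCompIso {S R : L ⥤ᵖ H} (α : S ⟶ R) {a b c : L} {f : a ⟶ b} {g : b ⟶ c}
    {h : a ⟶ c} (e : h = f ≫ g) :
    ((α_ (α.app a) (R.map f) (R.map g)).hom ≫ α.app a ◁ (mapCompIso R e).symm.hom) ≫
        (α.naturality h).symm.hom =
      (α.naturality f).symm.hom ▷ R.map g ≫ (α_ _ _ _).hom ≫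
        S.map f ◁ (α.naturality g).symm.hom ≫ (α_ _ _ _).inv ≫
          (mapCompIso S e).symm.hom ▷ α.app c :=
  (naturality_comp_iff_inv (α.app a) (mapCompIso R e) (mapCompIso S e) (α.naturality g)
    (α.naturality h) (α.naturality f)).1 (naturality_comp_aux α (eqToIso e).hom)

/-- A family of naturality isomorphisms compatible with identities is compatible with composition
with an identity on the left. -/
lemma naturality_comp_of_naturality_id {S R : L ⥤ᵖ H} {a b : L} (k : S.obj a ⟶ R.obj a)
    (m : S.obj b ⟶ R.obj b) (n : ∀ f : a ⟶ b, S.map f ≫ m ≅ k ≫ R.map f)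
    (n₁ : S.map (𝟙 a) ≫ k ≅ k ≫ R.map (𝟙 a))
    (h : n₁.hom ≫ k ◁ (R.mapId a).hom = (S.mapId a).hom ▷ k ≫ (λ_ k).hom ≫ (ρ_ k).inv)
    (g : a ⟶ b) :
    (n (𝟙 a ≫ g)).hom ≫ k ◁ (R.mapComp (𝟙 a) g).hom =
      (S.mapComp (𝟙 a) g).hom ▷ m ≫ (α_ _ _ _).hom ≫ S.map (𝟙 a) ◁ (n g).hom ≫
        (α_ _ _ _).inv ≫ n₁.hom ▷ R.map g ≫ (α_ _ _ _).hom := by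
  have nat {f f' : a ⟶ b} (η : f ⟶ f') : S.map₂ η ▷ m ≫ (n f').hom = (n f).hom ≫ k ◁ R.map₂ η := by
    obtain rfl := obj_ext_of_isDiscrete η
    obtain rfl : η = 𝟙 _ := Subsingleton.elim _ _
    simp
  have h' : n₁.hom = (S.mapId a).hom ▷ k ≫ (λ_ k).hom ≫ (ρ_ k).inv ≫ k ◁ (R.mapId a).inv := by
    rw [← cancel_mono (k ◁ (R.mapId a).hom), h]
    simp
  rw [h', S.mapComp_id_left_hom, R.mapComp_id_left_hom, whiskerLeft_comp, ← Category.assoc,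
    ← nat (λ_ g).hom]
  simp only [comp_whiskerRight, Category.assoc]
  congr 1
  have h₃ : (S.mapId a).inv ▷ S.map g ▷ m ≫ (α_ _ _ _).hom ≫ S.map (𝟙 a) ◁ (n g).hom =
      (α_ _ _ _).hom ≫ 𝟙 _ ◁ (n g).hom ≫ (S.mapId a).inv ▷ (k ≫ R.map g) := by
    rw [whisker_exchange]; simp
  rw [reassoc_of% h₃]
  simp

end MapComp

/-! ### Pseudofunctors on a category with an initial object adjoined -/

variable {C : Type*} [Category* C] {H : Type u} [Bicategory.{w, v} H]

variable (C) in
/-- The inclusion of a category into the one with an initial object adjoined, as a pseudofunctor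
between locally discrete bicategories. -/
abbrev inclStar : LocallyDiscrete C ⥤ᵖ LocallyDiscrete (WithInitial C) :=
  (WithInitial.incl : C ⥤ WithInitial C).toPseudofunctor

/-- The unique morphism from the adjoined initial object. -/
def fromStar (c : LocallyDiscrete C) :
    (⟨WithInitial.star⟩ : LocallyDiscrete (WithInitial C)) ⟶ (inclStar C).obj c :=
  (WithInitial.starInitial.to (WithInitial.of c.as)).toLoc

lemma fromStar_comp {c d : LocallyDiscrete C} (f : c ⟶ d) :
    fromStar d = fromStar c ≫ (inclStar C).map f := rfl

lemma inclStar_comp_mapId (S : LocallyDiscrete (WithInitial C) ⥤ᵖ H) (c : C) :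
    ((inclStar C).comp S).mapId ⟨c⟩ = S.mapId ⟨WithInitial.of c⟩ := by
  refine Iso.ext ?_
  have h (η : 𝟙 (⟨WithInitial.of c⟩ : LocallyDiscrete (WithInitial C)) ⟶ 𝟙 _) :
      S.map₂ η ≫ (S.mapId _).hom = (S.mapId _).hom := by
    rw [Subsingleton.elim η (𝟙 _), S.map₂_id, Category.id_comp]
  exact h _

lemma inclStar_comp_mapComp (S : LocallyDiscrete (WithInitial C) ⥤ᵖ H)
    {c d e : LocallyDiscrete C} (f : c ⟶ d) (g : d ⟶ e) :
    ((inclStar C).comp S).mapComp f g =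
      S.mapComp ((inclStar C).map f) ((inclStar C).map g) := by
  refine Iso.ext ?_
  have h (η : (inclStar C).map f ≫ (inclStar C).map g ⟶ (inclStar C).map f ≫ (inclStar C).map g) :
      S.map₂ η ≫ (S.mapComp _ _).hom = (S.mapComp _ _).hom := by
    rw [Subsingleton.elim η (𝟙 _), S.map₂_id, Category.id_comp]
  exact h _

lemma mapCompIso_fromStar_comp (S : LocallyDiscrete (WithInitial C) ⥤ᵖ H)
    {c d : LocallyDiscrete C} (f : c ⟶ d) :
    mapCompIso S (fromStar_comp f) = S.mapComp (fromStar c) ((inclStar C).map f) := by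
  refine Iso.ext ?_
  change S.map₂ (𝟙 _) ≫ _ = _
  rw [S.map₂_id]
  exact Category.id_comp _

/-- The pseudocone over the restriction of `S` with vertex the value of `S` at the adjoined initial
object. -/
def starCone (S : LocallyDiscrete (WithInitial C) ⥤ᵖ H) :
    PseudoCone ((inclStar C).comp S) (S.obj ⟨WithInitial.star⟩) where
  leg c := S.map (fromStar c)
  iso f := (mapCompIso S (fromStar_comp f)).symm
  iso_id c := mapCompIso_id S ((inclStar C).mapId c).hom _
  iso_comp f g := mapCompIso_comp S ((inclStar C).mapComp f g).hom _ _ _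

section Transformations

variable {S R : LocallyDiscrete (WithInitial C) ⥤ᵖ H}

/-- The comparison of pseudocones given by a pseudonatural transformation. -/
def starConeIso (α : S ⟶ R) : (starCone R).whisker (α.app ⟨WithInitial.star⟩) ≅
    (starCone S).postcomp (precompTrans (inclStar C) α) :=
  PseudoCone.isoMk (fun c => (α.naturality (fromStar c)).symm)
    (fun f => naturality_mapCompIso α (fromStar_comp f))

variable (k : S.obj ⟨WithInitial.star⟩ ⟶ R.obj ⟨WithInitial.star⟩)
  (β : (inclStar C).comp S ⟶ (inclStar C).comp R)

/-- The components of a pseudonatural transformation, from those at the adjoined initial object and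
at the other objects. -/
def starApp : ∀ a : LocallyDiscrete (WithInitial C), S.obj a ⟶ R.obj a
  | ⟨.of c⟩ => β.app ⟨c⟩
  | ⟨.star⟩ => k

/-- The naturality isomorphism at an identity that the unit axiom of pseudonatural transformations
prescribes. -/
def natId (S R : LocallyDiscrete (WithInitial C) ⥤ᵖ H) {a : LocallyDiscrete (WithInitial C)}
    (k : S.obj a ⟶ R.obj a) :
    S.map (𝟙 a) ≫ k ≅ k ≫ R.map (𝟙 a) :=
  whiskerRightIso (S.mapId a) k ≪≫ λ_ k ≪≫ (ρ_ k).symm ≪≫ whiskerLeftIso k (R.mapId a).symm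

variable (φ : (starCone R).whisker k ≅ (starCone S).postcomp β)

/-- The naturality isomorphisms belonging to `starApp`: those of `β` between objects of `C`, those
of `φ` at the morphisms out of the adjoined initial object, and the prescribed one at its
identity. -/
def starNat : ∀ {a b : LocallyDiscrete (WithInitial C)} (f : a ⟶ b),
    S.map f ≫ starApp k β b ≅ starApp k β a ≫ R.map f
  | ⟨.of c⟩, ⟨.of d⟩, ⟨f⟩ => β.naturality (a := ⟨c⟩) (b := ⟨d⟩) (WithInitial.down f).toLoc
  | ⟨.star⟩, ⟨.of d⟩, _ => (PseudoCone.isoApp φ ⟨d⟩).symm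
  | ⟨.star⟩, ⟨.star⟩, _ => natId S R k
  | ⟨.of _⟩, ⟨.star⟩, f => (WithInitial.false_of_to_star f.as).elim

lemma natId_hom {a : LocallyDiscrete (WithInitial C)} (k : S.obj a ⟶ R.obj a) :
    (natId S R k).hom ≫ k ◁ (R.mapId a).hom = (S.mapId a).hom ▷ k ≫ (λ_ k).hom ≫ (ρ_ k).inv := by
  simp [natId]

lemma starNat_comp_of {c d : LocallyDiscrete C} (f : c ⟶ d) :
    (PseudoCone.isoApp φ d).inv ≫ k ◁ (R.mapComp (fromStar c) ((inclStar C).map f)).hom =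
      (S.mapComp (fromStar c) ((inclStar C).map f)).hom ▷ β.app d ≫ (α_ _ _ _).hom ≫
        S.map (fromStar c) ◁ (β.naturality f).hom ≫ (α_ _ _ _).inv ≫
          (PseudoCone.isoApp φ c).inv ▷ R.map ((inclStar C).map f) ≫ (α_ _ _ _).hom := by
  have h := (naturality_comp_iff_inv k (mapCompIso R (fromStar_comp f))
    (mapCompIso S (fromStar_comp f)) (β.naturality f) (PseudoCone.isoApp φ d).symm
      (PseudoCone.isoApp φ c).symm).2 (φ.hom.naturality f)
  rw [mapCompIso_fromStar_comp, mapCompIso_fromStar_comp] at h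
  exact h

/-- The pseudonatural transformation determined by its component at the adjoined initial object, its
restriction, and a compatibility of the two. -/
def transOfStarConeIso : S ⟶ R :=
  strongTransMk (starApp k β) (starNat k β φ)
    (fun a => match a with
      | ⟨.of c⟩ => by
        have h := β.naturality_id ⟨c⟩
        rw [inclStar_comp_mapId, inclStar_comp_mapId] at h
        exact h
      | ⟨.star⟩ => natId_hom k)
    (fun {a b c} f g => match a, b, c, f, g with
      | ⟨.of c⟩, ⟨.of d⟩, ⟨.of e⟩, f, g => by
        have h := β.naturality_comp (a := ⟨c⟩) (b := ⟨d⟩) (c := ⟨e⟩)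
          (WithInitial.down f.as).toLoc (WithInitial.down g.as).toLoc
        rw [inclStar_comp_mapComp, inclStar_comp_mapComp] at h
        exact h
      | ⟨.star⟩, ⟨.of d⟩, ⟨.of e⟩, f, g =>
        starNat_comp_of k β φ (c := ⟨d⟩) (d := ⟨e⟩) (WithInitial.down g.as).toLoc
      | ⟨.star⟩, ⟨.star⟩, ⟨.of d⟩, _, g =>
        naturality_comp_of_naturality_id k (β.app ⟨d⟩)
          (fun _ => (PseudoCone.isoApp φ ⟨d⟩).symm) (natId S R k) (natId_hom k) g
      | ⟨.star⟩, ⟨.star⟩, ⟨.star⟩, _, g =>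
        naturality_comp_of_naturality_id k k (fun _ => natId S R k) (natId S R k) (natId_hom k) g
      | ⟨.of _⟩, ⟨.star⟩, _, f, _ => (WithInitial.false_of_to_star f.as).elim
      | _, ⟨.of _⟩, ⟨.star⟩, _, g => (WithInitial.false_of_to_star g.as).elim)

/-- The naturality of a modification at an identity is automatic. -/
lemma modification_naturality_id {α α' : S ⟶ R} {a : LocallyDiscrete (WithInitial C)}
    (Γ : α.app a ⟶ α'.app a) : S.map (𝟙 a) ◁ Γ ≫ (α'.naturality (𝟙 a)).hom =
      (α.naturality (𝟙 a)).hom ≫ Γ ▷ R.map (𝟙 a) := by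
  rw [Pseudofunctor.StrongTrans.naturality_id_hom, Pseudofunctor.StrongTrans.naturality_id_hom,
    whisker_exchange_assoc]
  have h : Γ ▷ 𝟙 _ ≫ α'.app a ◁ (R.mapId a).inv = α.app a ◁ (R.mapId a).inv ≫ Γ ▷ R.map (𝟙 a) :=
    (whisker_exchange _ _).symm
  simp only [Category.assoc, ← h]
  simp

/-- Modifications are determined by their components on `C` if the pseudocone of the target is
universal. -/
lemma modification_ext {α α' : S ⟶ R} {Γ Γ' : α ⟶ α'}
    (hR : (starCone R).IsUniversal)
    (h : (precompFunctor (inclStar C) S R).map Γ = (precompFunctor (inclStar C) S R).map Γ') :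
    Γ = Γ' := by
  have h' (c : LocallyDiscrete C) : Γ.as.app ((inclStar C).obj c) =
      Γ'.as.app ((inclStar C).obj c) := congrArg (fun Θ => Θ.as.app c) h
  refine Pseudofunctor.StrongTrans.homCategory.ext fun a => ?_
  rcases a with ⟨c | _⟩
  · exact h' ⟨c⟩
  · have := hR (S.obj ⟨WithInitial.star⟩)
    refine ((starCone R).whiskering _).map_injective (PseudoCone.hom_ext fun c => ?_)
    change Γ.as.app _ ▷ R.map (fromStar c) = Γ'.as.app _ ▷ R.map (fromStar c)
    rw [← cancel_epi (α.naturality (fromStar c)).hom, ← Γ.as.naturality, ← Γ'.as.naturality, h' c]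

/-- If the value of `R` at the adjoined initial object is the vertex of a universal pseudocone, then
transformations `S ⟶ R` are the same as transformations of the restrictions to `C`. -/
lemma isEquivalence_precompFunctor (S : LocallyDiscrete (WithInitial C) ⥤ᵖ H)
    (hR : (starCone R).IsUniversal) : (precompFunctor (inclStar C) S R).IsEquivalence where
  faithful := ⟨fun h => modification_ext hR h⟩
  full := ⟨fun {α α'} Θ => by
    have := hR (S.obj ⟨WithInitial.star⟩)
    obtain ⟨Γ, hΓ⟩ := ((starCone R).whiskering _).map_surjective
      ((starConeIso α).hom ≫ (starCone S).postcompMap Θ ≫ (starConeIso α').inv)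
    have hΓ' (c : LocallyDiscrete C) : S.map (fromStar c) ◁ Θ.as.app c ≫
        (α'.naturality (fromStar c)).hom =
          (α.naturality (fromStar c)).hom ≫ Γ ▷ R.map (fromStar c) := by
      have h : Γ ▷ R.map (fromStar c) = (α.naturality (fromStar c)).inv ≫
          S.map (fromStar c) ◁ Θ.as.app c ≫ (α'.naturality (fromStar c)).hom :=
        congrArg (fun Γ => PseudoCone.Hom.app Γ c) hΓ
      rw [h]
      exact (Iso.hom_inv_id_assoc _ _).symm
    refine ⟨⟨{ app := fun a => match a with
                | ⟨.of c⟩ => Θ.as.app ⟨c⟩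
                | ⟨.star⟩ => Γ
               naturality := fun {a b} f => match a, b, f with
                | ⟨.of c⟩, ⟨.of d⟩, f =>
                  Θ.as.naturality (a := ⟨c⟩) (b := ⟨d⟩) (WithInitial.down f.as).toLoc
                | ⟨.star⟩, ⟨.of d⟩, f => hΓ' ⟨d⟩
                | ⟨.star⟩, ⟨.star⟩, f => modification_naturality_id Γ
                | ⟨.of _⟩, ⟨.star⟩, f => (WithInitial.false_of_to_star f.as).elim }⟩, rfl⟩⟩
  essSurj := ⟨fun β => by
    have := hR (S.obj ⟨WithInitial.star⟩)
    exact ⟨transOfStarConeIso _ β (((starCone R).whiskering _).objObjPreimageIso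
      ((starCone S).postcomp β)), ⟨Iso.refl _⟩⟩⟩

end Transformations

/-! ### Right pseudo-Kan extensions -/

section Uniqueness

universe w₁ v₁ u₁ w₂ v₂ u₂ w₃ v₃ u₃

variable {B : Type u₁} [Bicategory.{w₁, v₁} B] {C : Type u₂} [Bicategory.{w₂, v₂} C]
  {D : Type u₃} [Bicategory.{w₃, v₃} D]

lemma kanComparison_comp {t : B ⥤ᵖ C} {A : B ⥤ᵖ D} {R R' S : C ⥤ᵖ D} (e : t.comp R ⟶ A)
    (α : S ⟶ R') (β : R' ⟶ R) : Nonempty ((kanComparison t A R e S).obj (α ≫ β) ≅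
      precompTrans t α ≫ (kanComparison t A R e R').obj β) :=
  ⟨α_ (precompTrans t α) (precompTrans t β) e⟩

lemma kanComparison_id {t : B ⥤ᵖ C} {A : B ⥤ᵖ D} {R : C ⥤ᵖ D} (e : t.comp R ⟶ A) :
    Nonempty ((kanComparison t A R e R).obj (𝟙 R) ≅ e) :=
  ⟨λ_ e⟩

/-- Right pseudo-Kan extensions are unique up to equivalence; in particular so are their values. -/
lemma IsRightPseudoKanExtension.nonempty_equivalence {t : B ⥤ᵖ C} {A : B ⥤ᵖ D} {R R' : C ⥤ᵖ D}
    (h : IsRightPseudoKanExtension t A R) (h' : IsRightPseudoKanExtension t A R') (c : C) :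
    Nonempty (R.obj c ≌ R'.obj c) := by
  obtain ⟨e, he⟩ := h
  obtain ⟨e', he'⟩ := h'
  -- a roundtrip between two extensions is compatible with the universal transformation
  have key {R R' : C ⥤ᵖ D} {e : t.comp R ⟶ A} {e' : t.comp R' ⟶ A}
      (he : ∀ S : C ⥤ᵖ D, (kanComparison t A R e S).IsEquivalence) (x : R ⟶ R') (y : R' ⟶ R)
      (hx : Nonempty ((kanComparison t A R' e' R).obj x ≅ e))
      (hy : Nonempty ((kanComparison t A R e R').obj y ≅ e')) : Nonempty (𝟙 R ≅ x ≫ y) := by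
    have := he R
    obtain ⟨i⟩ := kanComparison_comp e x y
    obtain ⟨i'⟩ := kanComparison_id e
    obtain ⟨hx⟩ := hx
    obtain ⟨hy⟩ := hy
    exact ⟨(kanComparison t A R e R).preimageIso
      (i' ≪≫ hx.symm ≪≫ whiskerLeftIso (precompTrans t x) hy.symm ≪≫ i.symm)⟩
  have := he R'
  have := he' R
  let x := (kanComparison t A R' e' R).objPreimage e
  let y := (kanComparison t A R e R').objPreimage e'
  have hx : Nonempty ((kanComparison t A R' e' R).obj x ≅ e) :=
    ⟨(kanComparison t A R' e' R).objObjPreimageIso e⟩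
  have hy : Nonempty ((kanComparison t A R e R').obj y ≅ e') :=
    ⟨(kanComparison t A R e R').objObjPreimageIso e'⟩
  obtain ⟨i⟩ := key he x y hx hy
  obtain ⟨i'⟩ := key he' y x hy hx
  let ev {S T : C ⥤ᵖ D} {α β : S ⟶ T} (i : α ≅ β) : α.app c ≅ β.app c :=
    { hom := i.hom.as.app c
      inv := i.inv.as.app c
      hom_inv_id := congrArg (fun Γ => Γ.as.app c) i.hom_inv_id
      inv_hom_id := congrArg (fun Γ => Γ.as.app c) i.inv_hom_id }
  exact ⟨Bicategory.Equivalence.mkOfAdjointifyCounit (ev i) (ev i').symm⟩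

end Uniqueness

/-- A pseudofunctor whose value at the adjoined initial object is the vertex of a universal
pseudocone is the right pseudo-Kan extension of its restriction, with the identity as the universal
transformation. -/
lemma isRightPseudoKanExtension_inclStar {R : LocallyDiscrete (WithInitial C) ⥤ᵖ H}
    (hR : (starCone R).IsUniversal) :
    IsRightPseudoKanExtension (inclStar C) ((inclStar C).comp R) R := by
  refine ⟨𝟙 _, fun S => ?_⟩
  have := isEquivalence_precompFunctor S hR
  let i : kanComparison (inclStar C) ((inclStar C).comp R) R (𝟙 _) S ≅
      precompFunctor (inclStar C) S R :=
    Functor.isoWhiskerLeft (precompFunctor (inclStar C) S R)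
      (rightUnitorNatIso ((inclStar C).comp S) ((inclStar C).comp R)) ≪≫ Functor.rightUnitor _
  exact (Functor.isEquivalence_iff_of_iso i).2 this

lemma map₂_eq_eqToHom {K : Type*} [Bicategory K] [IsLocallyDiscrete K] (A : K ⥤ᵖ H) {c d : K}
    {f g : c ⟶ d} (η : f ⟶ g) : A.map₂ η = eqToHom (congrArg A.map (obj_ext_of_isDiscrete η)) := by
  obtain rfl := obj_ext_of_isDiscrete η
  obtain rfl : η = 𝟙 _ := Subsingleton.elim _ _
  exact A.map₂_id _

lemma PseudoCone.iso_comp_inv {K : Type*} [Bicategory K] {A : K ⥤ᵖ H} {X : H} (p : PseudoCone A X)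
    {c d e : K} (f : c ⟶ d) (g : d ⟶ e) :
    (p.iso g).inv ≫ (p.iso f).inv ▷ A.map g ≫ (α_ _ _ _).hom ≫ p.leg c ◁ (A.mapComp f g).inv ≫
      (p.iso (f ≫ g)).hom = 𝟙 _ := by
  rw [p.iso_comp]
  simp

/-- Extensionality for pseudofunctors on a locally discrete bicategory. -/
lemma pseudofunctor_ext {K : Type*} [Bicategory K] [IsLocallyDiscrete K] {F G : K ⥤ᵖ H}
    (h : F.toPrefunctor = G.toPrefunctor) (hId : HEq F.mapId G.mapId)
    (hComp : HEq @F.mapComp @G.mapComp) : F = G := by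
  have h₂ {c d : K} {f g : c ⟶ d} (η : f ⟶ g) := map₂_eq_eqToHom F η
  have h₂' {c d : K} {f g : c ⟶ d} (η : f ⟶ g) := map₂_eq_eqToHom G η
  rcases F with ⟨⟨⟨F, F₂⟩, _, _⟩, FId, FComp, _, _, _, _, _⟩
  rcases G with ⟨⟨⟨G, G₂⟩, _, _⟩, GId, GComp, _, _, _, _, _⟩
  obtain rfl : F = G := h
  obtain rfl : @F₂ = @G₂ := by
    funext c d f g η
    exact (h₂ η).trans (h₂' η).symm
  obtain rfl : FId = GId := eq_of_heq hId
  obtain rfl : @FComp = @GComp := eq_of_heq hComp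
  rfl

lemma PseudoCone.isUniversal_of_eq {K : Type*} [Bicategory K] {A B : K ⥤ᵖ H} (h : A = B) {X : H}
    {p : PseudoCone A X} {q : PseudoCone B X} (hleg : HEq p.leg q.leg)
    (hiso : HEq @p.iso @q.iso) (hq : q.IsUniversal) : p.IsUniversal := by
  subst h
  rcases p with ⟨pl, pi, _, _⟩
  rcases q with ⟨ql, qi, _, _⟩
  obtain rfl : pl = ql := eq_of_heq hleg
  obtain rfl : @pi = @qi := eq_of_heq hiso
  exact hq

section Extension

variable {A : LocallyDiscrete C ⥤ᵖ H} {D : H} (p : PseudoCone A D)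

variable (A D) in
/-- The objects of `coneExtension`. -/
def extObj : WithInitial C → H
  | .of c => A.obj ⟨c⟩
  | .star => D

/-- The `1`-cells of `coneExtension`. -/
def extMap : ∀ {a b : WithInitial C}, (a ⟶ b) → (extObj A D a ⟶ extObj A D b)
  | .of _, .of _, f => A.map (WithInitial.down f).toLoc
  | .star, .of c, _ => p.leg ⟨c⟩
  | .star, .star, _ => 𝟙 D
  | .of _, .star, f => (WithInitial.false_of_to_star f).elim

/-- The unit isomorphisms of `coneExtension`. -/
def extMapId : ∀ a : WithInitial C, extMap p (𝟙 a) ≅ 𝟙 (extObj A D a)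
  | .of c => A.mapId ⟨c⟩
  | .star => Iso.refl _

/-- The composition isomorphisms of `coneExtension`. -/
def extMapComp : ∀ {a b c : WithInitial C} (f : a ⟶ b) (g : b ⟶ c),
    extMap p (f ≫ g) ≅ extMap p f ≫ extMap p g
  | .of _, .of _, .of _, f, g => A.mapComp (WithInitial.down f).toLoc (WithInitial.down g).toLoc
  | .star, .of _, .of _, _, g => (p.iso (WithInitial.down g).toLoc).symm
  | .star, .star, .of c, _, _ => (λ_ (p.leg ⟨c⟩)).symm
  | .star, .star, .star, _, _ => (λ_ (𝟙 D)).symm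
  | .of _, .star, _, f, _ => (WithInitial.false_of_to_star f).elim
  | _, .of _, .star, _, g => (WithInitial.false_of_to_star g).elim

/-- The extension of a pseudofunctor to a category with an initial object adjoined that is given by
a pseudocone: the initial object is sent to the vertex of the pseudocone. -/
def coneExtension : LocallyDiscrete (WithInitial C) ⥤ᵖ H :=
  LocallyDiscrete.mkPseudofunctor (extObj A D) (extMap p) (extMapId p) (extMapComp p)
    (fun {a b c d} f g h => match a, b, c, d, f, g, h with
      | .of a, .of b, .of c, .of d, f, g, h =>
        (A.map₂_associator (WithInitial.down f).toLoc (WithInitial.down g).toLoc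
          (WithInitial.down h).toLoc).symm.trans (map₂_eq_eqToHom A _)
      | .star, .of b, .of c, .of d, _, g, h =>
        p.iso_comp_inv (WithInitial.down g).toLoc (WithInitial.down h).toLoc
      | .star, .star, .of c, .of d, _, _, h => by
        have e : (p.iso (WithInitial.down h).toLoc).inv ≫ (λ_ _).inv ▷ _ ≫ (α_ _ _ _).hom ≫
          𝟙 _ ◁ (p.iso (WithInitial.down h).toLoc).hom ≫ (λ_ _).hom = 𝟙 _ := by simp
        exact e
      | .star, .star, .star, .of d, _, _, _ => by
        have e : (λ_ (p.leg ⟨d⟩)).inv ≫ (λ_ (𝟙 D)).inv ▷ p.leg ⟨d⟩ ≫ (α_ _ _ _).hom ≫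
          𝟙 D ◁ (λ_ (p.leg ⟨d⟩)).hom ≫ (λ_ (p.leg ⟨d⟩)).hom = 𝟙 _ := by simp
        exact e
      | .star, .star, .star, .star, _, _, _ => by
        have e : (λ_ (𝟙 D)).inv ≫ (λ_ (𝟙 D)).inv ▷ 𝟙 D ≫ (α_ _ _ _).hom ≫
          𝟙 D ◁ (λ_ (𝟙 D)).hom ≫ (λ_ (𝟙 D)).hom = 𝟙 _ := by simp
        exact e
      | .of _, .star, _, _, f, _, _ => (WithInitial.false_of_to_star f).elim
      | _, .of _, .star, _, _, g, _ => (WithInitial.false_of_to_star g).elim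
      | _, _, .of _, .star, _, _, h => (WithInitial.false_of_to_star h).elim)
    (fun {a b} f => match a, b, f with
      | .of a, .of b, f =>
        (A.map₂_left_unitor (WithInitial.down f).toLoc).symm.trans (map₂_eq_eqToHom A _)
      | .star, .of b, _ => by
        have e : (λ_ (p.leg ⟨b⟩)).inv ≫ 𝟙 (𝟙 D) ▷ p.leg ⟨b⟩ ≫ (λ_ (p.leg ⟨b⟩)).hom = 𝟙 _ := by simp
        exact e
      | .star, .star, _ => by
        have e : (λ_ (𝟙 D)).inv ≫ 𝟙 (𝟙 D) ▷ 𝟙 D ≫ (λ_ (𝟙 D)).hom = 𝟙 _ := by simp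
        exact e
      | .of _, .star, f => (WithInitial.false_of_to_star f).elim)
    (fun {a b} f => match a, b, f with
      | .of a, .of b, f =>
        (A.map₂_right_unitor (WithInitial.down f).toLoc).symm.trans (map₂_eq_eqToHom A _)
      | .star, .of b, _ => by
        have e : (p.iso (𝟙 ⟨b⟩)).inv ≫ p.leg ⟨b⟩ ◁ (A.mapId ⟨b⟩).hom ≫ (ρ_ _).hom = 𝟙 _ := by
          rw [← p.iso_id, Iso.inv_hom_id]
        exact e
      | .star, .star, _ => by
        have e : (λ_ (𝟙 D)).inv ≫ 𝟙 D ◁ 𝟙 (𝟙 D) ≫ (ρ_ (𝟙 D)).hom = 𝟙 _ := by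
          simp
        exact e
      | .of _, .star, f => (WithInitial.false_of_to_star f).elim)

/-- The extension restricts to `A` on the nose, so that no coherence isomorphism is needed. -/
lemma inclStar_comp_coneExtension : (inclStar C).comp (coneExtension p) = A :=
  pseudofunctor_ext rfl
    (heq_of_eq (funext fun c => inclStar_comp_mapId (coneExtension p) c.as))
    (heq_of_eq (funext fun _ => funext fun _ => funext fun _ => funext fun f => funext fun g =>
      inclStar_comp_mapComp (coneExtension p) f g))

lemma isUniversal_starCone_coneExtension (hp : p.IsUniversal) :
    (starCone (coneExtension p)).IsUniversal := by
  refine PseudoCone.isUniversal_of_eq (inclStar_comp_coneExtension p) ?_ ?_ hp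
  · exact HEq.rfl
  · refine heq_of_eq ?_
    funext c d f
    refine Iso.ext ?_
    exact congrArg Iso.inv (mapCompIso_fromStar_comp (coneExtension p) f)

lemma isRightPseudoKanExtension_coneExtension (hp : p.IsUniversal) :
    IsRightPseudoKanExtension (inclStar C) A (coneExtension p) := by
  have h := isRightPseudoKanExtension_inclStar (isUniversal_starCone_coneExtension p hp)
  rwa [inclStar_comp_coneExtension] at h

end Extension

end PseudoKan

theorem mainTheorem1 {H : Type u} [Bicategory.{w, v} H] [Bicategory.Strict H]
    (A : LocallyDiscrete SimplexCategory ⥤ᵖ H) :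
    (∀ D : H, PseudoKan.IsDescentObject A D ↔ PseudoKan.IsConicalBilimit A D) ∧
    ((∃ D : H, PseudoKan.IsDescentObject A D) ↔
      ∀ n : AugmentedSimplexCategory, ∃ L : H,
        PseudoKan.IsWeightedBilimit (PseudoKan.representableWeight PseudoKan.j n) A L) ∧
    (∀ D : H, PseudoKan.IsDescentObject A D →
      (∃ R : LocallyDiscrete AugmentedSimplexCategory ⥤ᵖ H,
        PseudoKan.IsRightPseudoKanExtension PseudoKan.j.toPseudofunctor A R) ∧
      ∀ R : LocallyDiscrete AugmentedSimplexCategory ⥤ᵖ H,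
        PseudoKan.IsRightPseudoKanExtension PseudoKan.j.toPseudofunctor A R →
          Nonempty (D ≌ R.obj ⟨PseudoKan.zeroOrdinal⟩)) := by
  refine ⟨fun D => (PseudoKan.isDescentObject_iff A D).trans
    (PseudoKan.isConicalBilimit_iff A D).symm, PseudoKan.exists_isWeightedBilimit_iff A,
    fun D hD => ?_⟩
  obtain ⟨p, hp⟩ := (PseudoKan.isDescentObject_iff A D).1 hD
  have hR : PseudoKan.IsRightPseudoKanExtension PseudoKan.j.toPseudofunctor A
      (PseudoKan.coneExtension p) := PseudoKan.isRightPseudoKanExtension_coneExtension p hp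
  exact ⟨⟨_, hR⟩, fun R hR' => hR.nonempty_equivalence hR' ⟨PseudoKan.zeroOrdinal⟩⟩
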